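/- Let $\mathcal H$ be a separable complex Hilbert space and let $\mathcal K=L^2(\mathbb R;\mathcal H)$. For $\sigma\in\mathbb R$ let $(T_\sigma f)(t)=f(t-\sigma)$ on $\mathcal K$, and for $\phi\in L^\infty(\mathbb R)$ let $(M(\phi)f)(t)=\phi(t)f(t)$. An operator $K$ on $\mathcal K$ is said to generate a unitary evolution group of period $1$ if it is the (self-adjoint) generator of a strongly continuous unitary group $e^{-i\sigma K}$, $\sigma\in\mathbb R$, such that $e^{-i\sigma K}T_\sigma^*$ commutes with $M(\phi)$ for all $\sigma\in\mathbb R$ and $\phi\in L^\infty(\mathbb R)$, and if $K$ commutes with $T_1$ (that is, $T_1K\subseteq KT_1$). Let $\ell_2(\mathcal H)$ be the space of square summable sequences $(x_n)_{n\in\mathbb Z}$ in $\mathcal H$, let $S$ be the bilateral shift $(Sx)_n=x_{n-1}$ on it, and let $\mathcal T$ be the unitary map from $\mathcal K$ onto $L^2((0,2\pi);\ell_2(\mathcal H))$ given by $$(\mathcal Tf)(\theta)_n=\hat f(2\pi n+\theta),\qquad \hat f(k)=(2\pi)^{-1/2}\int_{-\infty}^{\infty}e^{-ikt}f(t)\,dt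 .$$ For a self-adjoint operator $\tilde K$ on $\ell_2(\mathcal H)$ let $M(\tilde K+\theta)$ be the operator on $L^2((0,2\pi);\ell_2(\mathcal H))$ that maps $g$ to $\theta\mapsto(\tilde K+\theta)g(\theta)$, with domain all $g$ such that $g(\theta)\in D(\tilde K)$ for almost every $\theta$ and $\theta\mapsto(\tilde K+\theta)g(\theta)$ is in $L^2((0,2\pi);\ell_2(\mathcal H))$. **Theorem 2.** (i) If $K$ generates a unitary evolution group of period $1$, then there is a unique self-adjoint operator $\tilde K$ on $\ell_2(\mathcal H)$ such that $$\mathcal TK\mathcal T^*=M(\tilde K+\theta)$$ (equality of unbounded operators, including their domains), and this operator satisfies $$S e^{-i\sigma\tilde K}=e^{2\pi i\sigma}e^{-i\sigma\tilde K}S\qquad\text{for all }\sigma\in\mathbb R. \tag{$*$}$$ (ii) Conversely, if $\tilde K$ is a self-adjoint operator on $\ell_2(\mathcal H)$ that satisfies $(*)$, then $K=\mathcal T^*M(\tilde K+\theta)\mathcal T$ generates a unitary evolution group of period $1$. -/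

import Mathlib

open MeasureTheory
open scoped ENNReal FourierTransform

noncomputable section

set_option linter.unusedSectionVars false

namespace Floquet

/-! ### Unitary groups, generators, exponentials -/

section Abstract

variable {E F : Type*} [NormedAddCommGroup E] [InnerProductSpace ℂ E]
  [NormedAddCommGroup F] [InnerProductSpace ℂ F]

/-- A strongly continuous one-parameter group of unitary operators. -/
structure UnitaryGroup (E : Type*) [NormedAddCommGroup E] [InnerProductSpace ℂ E] where
  /-- the unitary operator with parameter `σ` -/
  toFun : ℝ → E ≃ₗᵢ[ℂ] E
  map_add : ∀ (s t : ℝ) (x : E), toFun (s + t) x = toFun s (toFun t x)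
  strongly_continuous : ∀ x : E, Continuous fun σ : ℝ => toFun σ x

/-- `K` is the generator of `U σ = exp (-iσK)`: a vector `x` lies in the domain of `K`, with
`K x = y`, if and only if `σ ↦ U σ x` has derivative `-i y` at `σ = 0`. -/
def IsGeneratorOf (K : E →ₗ.[ℂ] E) (U : UnitaryGroup E) : Prop :=
  ∀ x y : E, (x, y) ∈ K.graph ↔
    HasDerivAt (fun σ : ℝ => U.toFun σ x) (-(Complex.I • y)) 0

open Classical in
/-- `exp (-iσA)`: the member with parameter `σ` of the unitary group generated by `A`. Every
self-adjoint `A` generates exactly one such group (Stone); the identity is a default value for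
operators that generate none. -/
def expNegI (A : E →ₗ.[ℂ] E) (σ : ℝ) : E ≃ₗᵢ[ℂ] E :=
  if h : ∃ U : UnitaryGroup E, IsGeneratorOf A U then h.choose.toFun σ
  else LinearIsometryEquiv.refl ℂ E

/-- The unbounded operator `V K V*`, with domain `V D(K)`, for a unitary map `V`. -/
def unitaryConj (V : E ≃ₗᵢ[ℂ] F) (K : E →ₗ.[ℂ] E) : F →ₗ.[ℂ] F where
  domain := K.domain.comap (V.symm.toLinearEquiv : F →ₗ[ℂ] E)
  toFun :=
    { toFun := fun y => V (K ⟨V.symm y.1, y.2⟩)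
      map_add' := by
        intro y z
        rw [← map_add, ← LinearPMap.map_add]
        congr 2
        exact Subtype.ext (map_add V.symm y.1 z.1)
      map_smul' := by
        intro c y
        rw [RingHom.id_apply, ← map_smul, ← LinearPMap.map_smul]
        congr 2
        exact Subtype.ext (map_smul V.symm c y.1) }

/-- The unbounded operator `K` commutes with the everywhere defined operator `B`: `B K ⊆ K B`. -/
def CommutesWith (K : E →ₗ.[ℂ] E) (B : E → E) : Prop :=
  ∀ x y : E, (x, y) ∈ K.graph → (B x, B y) ∈ K.graph

variable {α : Type*} [MeasurableSpace α] {μ : Measure α}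

/-- The graph of the multiplication operator by a family of (unbounded) operators. -/
def multiplicationGraph (μ : Measure α) (A : α → E →ₗ.[ℂ] E) :
    Submodule ℂ (Lp E 2 μ × Lp E 2 μ) where
  carrier := {p | ∀ᵐ a ∂μ, (p.1 a, p.2 a) ∈ (A a).graph}
  add_mem' := by
    rintro ⟨f, f'⟩ ⟨g, g'⟩ hf hg
    filter_upwards [hf, hg, Lp.coeFn_add f g, Lp.coeFn_add f' g'] with a h1 h2 h3 h4
    simp only [Prod.mk_add_mk] at *
    rw [h3, h4]
    exact (A a).graph.add_mem h1 h2
  zero_mem' := by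
    filter_upwards [Lp.coeFn_zero E 2 μ] with a h
    simp only [Prod.fst_zero, Prod.snd_zero]
    rw [h]
    exact (A a).graph.zero_mem
  smul_mem' := by
    rintro c ⟨f, f'⟩ hf
    filter_upwards [hf, Lp.coeFn_smul c f, Lp.coeFn_smul c f'] with a h1 h2 h3
    simp only [Prod.smul_mk] at *
    rw [h2, h3]
    exact (A a).graph.smul_mem c h1

/-- The multiplication operator `M(A(a))` on `L²(μ; E)`, for a family `A` of operators: its domain
consists of the `f` in `L²` for which `f a` is in the domain of `A a` for almost every `a` and
`a ↦ A a (f a)` is again in `L²`, and this function is then its value at `f`. -/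
def multiplication (μ : Measure α) (A : α → E →ₗ.[ℂ] E) : Lp E 2 μ →ₗ.[ℂ] Lp E 2 μ :=
  (multiplicationGraph μ A).toLinearPMap

theorem mem_graph_multiplication (A : α → E →ₗ.[ℂ] E) (f g : Lp E 2 μ) :
    (f, g) ∈ (multiplication μ A).graph ↔ ∀ᵐ a ∂μ, (f a, g a) ∈ (A a).graph := by
  unfold multiplication
  rw [Submodule.toLinearPMap_graph_eq]
  · rfl
  · rintro ⟨f, g⟩ h hf
    have h' : ∀ᵐ a ∂μ, (f a, g a) ∈ (A a).graph := h
    simp only at hf ⊢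
    subst hf
    refine Lp.ext ?_
    filter_upwards [h', Lp.coeFn_zero E 2 μ] with a h1 h2
    rw [h2] at h1 ⊢
    exact (A a).graph_fst_eq_zero_snd h1 rfl

end Abstract

/-! ### The spaces `L²(ℝ; H)` and `ℓ²(H)`, time translation, the bilateral shift -/

section Concrete

variable (H : Type*) [NormedAddCommGroup H] [InnerProductSpace ℂ H]

/-- `L²(ℝ; H)`. -/
abbrev L2R : Type _ := Lp H 2 (volume : Measure ℝ)

/-- `ℓ²(H)`, the square summable bilateral sequences in `H`. -/
abbrev Ell2 : Type _ := lp (fun _ : ℤ => H) 2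

/-- Lebesgue measure on `(0, 2π)`. -/
abbrev circleMeasure : Measure ℝ := volume.restrict (Set.Ioo 0 (2 * Real.pi))

/-- `L²((0, 2π); ℓ²(H))`. -/
abbrev L2Ell2 : Type _ := Lp (Ell2 H) 2 circleMeasure

variable {H}

theorem translate_translate (s t : ℝ) (h : t + s = 0) (f : L2R H) :
    Lp.compMeasurePreserving (fun x : ℝ => x - s) (measurePreserving_sub_right volume s)
      (Lp.compMeasurePreserving (fun x : ℝ => x - t) (measurePreserving_sub_right volume t) f)
      = f := by
  rw [← Lp.compMeasurePreserving_comp_apply]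
  have : ((fun x : ℝ => x - t) ∘ fun x : ℝ => x - s) = id := by
    funext x
    simp only [Function.comp, id]
    linarith
  simp [this]

/-- Time translation: `(T σ f)(t) = f (t - σ)`. -/
def timeTranslation (σ : ℝ) : L2R H ≃ₗᵢ[ℂ] L2R H where
  toFun := Lp.compMeasurePreserving (fun x : ℝ => x - σ) (measurePreserving_sub_right volume σ)
  invFun := Lp.compMeasurePreserving (fun x : ℝ => x - (-σ))
    (measurePreserving_sub_right volume (-σ))
  map_add' := map_add _
  map_smul' := (Lp.compMeasurePreservingₗ ℂ (fun x : ℝ => x - σ)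
    (measurePreserving_sub_right volume σ)).map_smul
  left_inv f := translate_translate (-σ) σ (by simp) f
  right_inv f := translate_translate σ (-σ) (by simp) f
  norm_map' f := Lp.norm_compMeasurePreserving f (measurePreserving_sub_right volume σ)

/-- `U σ ∘ (T σ)*` commutes with every scalar multiplication `M(φ)`, `φ ∈ L^∞(ℝ)`. -/
def IsEvolutionGroup (U : UnitaryGroup (L2R H)) : Prop :=
  ∀ (σ : ℝ) (φ : Lp ℂ ∞ (volume : Measure ℝ)) (f : L2R H),
    U.toFun σ ((timeTranslation σ).symm (φ • f : L2R H)) =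
      (φ • U.toFun σ ((timeTranslation σ).symm f) : L2R H)

/-- `K` generates a unitary evolution group of period `a`. -/
def GeneratesPeriodicEvolutionGroup (K : L2R H →ₗ.[ℂ] L2R H) (a : ℝ) : Prop :=
  (∃ U : UnitaryGroup (L2R H), IsGeneratorOf K U ∧ IsEvolutionGroup U) ∧
    CommutesWith K (timeTranslation a)

theorem memℓp_comp_equiv (e : ℤ ≃ ℤ) (x : Ell2 H) : Memℓp (fun n => x (e n)) 2 := by
  have h := (lp.memℓp x).summable (by norm_num)
  exact memℓp_gen (h.comp_injective e.injective)

/-- The bilateral shift on `ℓ²(H)`: `(S x) n = x (n - 1)`. -/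
def bilateralShift : Ell2 H ≃ₗᵢ[ℂ] Ell2 H where
  toFun x := ⟨fun n => x (n - 1), memℓp_comp_equiv (Equiv.subRight 1) x⟩
  invFun x := ⟨fun n => x (n + 1), memℓp_comp_equiv (Equiv.addRight 1) x⟩
  map_add' _ _ := rfl
  map_smul' _ _ := rfl
  left_inv x := lp.ext (by funext n; simp)
  right_inv x := lp.ext (by funext n; simp)
  norm_map' x := by
    rw [lp.norm_eq_tsum_rpow (by norm_num), lp.norm_eq_tsum_rpow (by norm_num)]
    congr 1
    exact (Equiv.subRight (1 : ℤ)).tsum_eq fun n => ‖x n‖ ^ (2 : ℝ≥0∞).toReal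

/-- The commutation relation `S exp(-iσA) = exp(2πiσ) exp(-iσA) S` for all real `σ`. -/
def ShiftRelation (A : Ell2 H →ₗ.[ℂ] Ell2 H) : Prop :=
  ∀ (σ : ℝ) (x : Ell2 H), bilateralShift (expNegI A σ x) =
    Complex.exp (2 * Real.pi * Complex.I * σ) • expNegI A σ (bilateralShift x)

end Concrete

/-! ### The Floquet–Bloch transform -/

section Fiber

variable {H : Type*} [NormedAddCommGroup H] [InnerProductSpace ℂ H]

theorem enorm_sq_ell2 (x : Ell2 H) : ‖x‖ₑ ^ (2 : ℝ) = ∑' n : ℤ, ‖x n‖ₑ ^ (2 : ℝ) := by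
  have h := lp.hasSum_norm (p := 2) (by norm_num) x
  have h2 : (2 : ℝ≥0∞).toReal = 2 := by norm_num
  rw [h2] at h
  have key : ∀ {G : Type _} [NormedAddCommGroup G] (y : G),
      ‖y‖ₑ ^ (2 : ℝ) = ENNReal.ofReal (‖y‖ ^ (2 : ℝ)) := by
    intro G _ y
    rw [← ofReal_norm, ENNReal.ofReal_rpow_of_nonneg (norm_nonneg _) (by norm_num)]
  have key' : ∀ y : H, ‖y‖ₑ ^ (2 : ℝ) = ENNReal.ofReal (‖y‖ ^ (2 : ℝ)) := by
    intro y
    rw [← ofReal_norm, ENNReal.ofReal_rpow_of_nonneg (norm_nonneg _) (by norm_num)]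
  rw [key x, ← h.tsum_eq, ENNReal.ofReal_tsum_of_nonneg (fun n => by positivity) h.summable]
  exact tsum_congr fun n => (key' (x n)).symm

theorem memℓp_two_of_tsum_lt_top (x : ℤ → H) (h : ∑' n : ℤ, ‖x n‖ₑ ^ (2 : ℝ) < ∞) :
    Memℓp x 2 := by
  refine memℓp_gen ?_
  have h2 : (2 : ℝ≥0∞).toReal = 2 := by norm_num
  rw [h2]
  have hs := ENNReal.summable_toReal h.ne
  refine hs.congr fun n => ?_
  rw [← ENNReal.toReal_rpow, toReal_enorm]

/-- The interval `(0, 2π)` is mapped onto `(n, n + 1)`. -/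
theorem lintegral_unit_interval (f : ℝ → ℝ≥0∞) (n : ℤ) :
    ∫⁻ x in Set.Ioo (n : ℝ) (n + 1), f x =
      ∫⁻ θ, ENNReal.ofReal (2 * Real.pi)⁻¹ * f (n + θ / (2 * Real.pi)) ∂circleMeasure := by
  have hpi : 0 < 2 * Real.pi := by positivity
  have himg : (fun θ : ℝ => (n : ℝ) + θ / (2 * Real.pi)) '' Set.Ioo 0 (2 * Real.pi)
      = Set.Ioo (n : ℝ) (n + 1) := by
    ext x
    constructor
    · rintro ⟨θ, ⟨h0, h1⟩, rfl⟩
      have h3 : 0 < θ / (2 * Real.pi) := by positivity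
      have h4 : θ / (2 * Real.pi) < 1 := (div_lt_one hpi).2 h1
      exact ⟨by simpa using h3, by simpa using h4⟩
    · rintro ⟨h0, h1⟩
      refine ⟨(x - n) * (2 * Real.pi), ⟨mul_pos (by linarith) hpi, ?_⟩, ?_⟩
      · nlinarith
      · simp only
        rw [mul_div_assoc, div_self hpi.ne']
        ring
  rw [← himg, lintegral_image_eq_lintegral_abs_deriv_mul measurableSet_Ioo
    (f' := fun _ => (2 * Real.pi)⁻¹)]
  · simp only [abs_of_pos (inv_pos.2 hpi)]
  · intro θ _
    have := ((hasDerivAt_id θ).div_const (2 * Real.pi)).const_add (n : ℝ)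
    simpa using this.hasDerivWithinAt
  · intro a _ b _ hab
    simp only [add_right_inj] at hab
    exact (div_left_inj' hpi.ne').1 hab

theorem lintegral_eq_tsum_fibers (f : ℝ → ℝ≥0∞) :
    ∫⁻ x, f x =
      ∑' n : ℤ, ∫⁻ θ, ENNReal.ofReal (2 * Real.pi)⁻¹ * f (n + θ / (2 * Real.pi))
        ∂circleMeasure := by
  have h1 : ∫⁻ x, f x = ∑' n : ℤ, ∫⁻ x in Set.Ico (n : ℝ) (n + 1), f x := by
    rw [← lintegral_iUnion (fun n => measurableSet_Ico) (Set.pairwise_disjoint_Ico_intCast ℝ),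
      iUnion_Ico_intCast, setLIntegral_univ]
  rw [h1]
  refine tsum_congr fun n => ?_
  rw [← lintegral_unit_interval, Measure.restrict_congr_set Ioo_ae_eq_Ico]

/-- If a property holds almost everywhere on `ℝ`, then for almost every `θ` it holds at all points
`n + θ / 2π`. -/
theorem ae_fibers {P : ℝ → Prop} (h : ∀ᵐ x : ℝ, P x) :
    ∀ᵐ θ ∂circleMeasure, ∀ n : ℤ, P (n + θ / (2 * Real.pi)) := by
  have hpi : 0 < 2 * Real.pi := by positivity
  rw [ae_all_iff]
  intro n
  refine ae_restrict_of_ae ?_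
  have hq : Measure.QuasiMeasurePreserving (fun θ : ℝ => (n : ℝ) + θ / (2 * Real.pi))
      volume volume := by
    refine (measurePreserving_add_left volume (n : ℝ)).quasiMeasurePreserving.comp
      (f := fun θ : ℝ => θ / (2 * Real.pi)) ⟨by fun_prop, ?_⟩
    have : (fun θ : ℝ => θ / (2 * Real.pi)) = fun θ => (2 * Real.pi)⁻¹ * θ := by
      funext θ
      rw [div_eq_inv_mul]
    rw [this, Real.map_volume_mul_left (inv_ne_zero hpi.ne')]
    exact Measure.smul_absolutelyContinuous
  exact hq.ae h

/-- The scalar `(2π)^(-1/2)`. -/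
def fiberScale : ℂ := ((Real.sqrt (2 * Real.pi))⁻¹ : ℝ)

theorem fiberScale_ne_zero : fiberScale ≠ 0 := by
  have hpi : 0 < 2 * Real.pi := by positivity
  have := Real.sqrt_pos.2 hpi
  rw [fiberScale]
  exact_mod_cast (inv_ne_zero this.ne')

theorem enorm_fiberScale_smul (y : H) :
    ‖fiberScale • y‖ₑ ^ (2 : ℝ) = ENNReal.ofReal (2 * Real.pi)⁻¹ * ‖y‖ₑ ^ (2 : ℝ) := by
  have hpi : 0 < 2 * Real.pi := by positivity
  rw [enorm_smul, ENNReal.mul_rpow_of_nonneg _ _ (by norm_num)]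
  congr 1
  rw [← ofReal_norm, ENNReal.ofReal_rpow_of_nonneg (norm_nonneg _) (by norm_num)]
  congr 1
  rw [fiberScale, Complex.norm_real, Real.norm_eq_abs, abs_of_nonneg (by positivity),
    Real.rpow_two, inv_pow, Real.sq_sqrt hpi.le]

theorem lintegral_fibers (h : ℝ → H) (hm : StronglyMeasurable h) :
    ∫⁻ θ, ∑' n : ℤ, ‖fiberScale • h (n + θ / (2 * Real.pi))‖ₑ ^ (2 : ℝ) ∂circleMeasure
      = ∫⁻ x, ‖h x‖ₑ ^ (2 : ℝ) := by
  rw [lintegral_eq_tsum_fibers, lintegral_tsum]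
  · refine tsum_congr fun n => lintegral_congr fun θ => ?_
    rw [enorm_fiberScale_smul]
  · intro n
    have : StronglyMeasurable fun θ : ℝ => fiberScale • h (n + θ / (2 * Real.pi)) :=
      (hm.comp_measurable (by fun_prop)).const_smul fiberScale
    exact (this.enorm.pow_const _).aemeasurable

open Classical in
/-- The sequence `n ↦ (2π)^(-1/2) h (n + θ / 2π)`, for those `θ` for which it is square summable. -/
def fiberFun (h : ℝ → H) (θ : ℝ) : Ell2 H :=
  if hx : Memℓp (fun n : ℤ => fiberScale • h (n + θ / (2 * Real.pi))) 2 then ⟨_, hx⟩ else 0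

theorem lintegral_enorm_sq_lt_top {α G : Type*} [MeasurableSpace α] {μ : Measure α}
    [NormedAddCommGroup G] (f : Lp G 2 μ) : ∫⁻ x, ‖f x‖ₑ ^ (2 : ℝ) ∂μ < ∞ := by
  have := lintegral_rpow_enorm_lt_top_of_eLpNorm_lt_top (p := 2) (by norm_num) (by norm_num)
    (Lp.memLp f).2
  simpa using this

/-- For almost every `θ` the sequence is square summable. -/
theorem fiberFun_apply (h : L2R H) :
    ∀ᵐ θ ∂circleMeasure, ∀ n : ℤ,
      fiberFun h θ n = fiberScale • h (n + θ / (2 * Real.pi)) := by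
  have hfin : ∫⁻ θ, ∑' n : ℤ, ‖fiberScale • h (n + θ / (2 * Real.pi))‖ₑ ^ (2 : ℝ)
      ∂circleMeasure ≠ ∞ := by
    rw [lintegral_fibers _ (Lp.stronglyMeasurable h)]
    exact (lintegral_enorm_sq_lt_top h).ne
  have hmeas : Measurable fun θ : ℝ =>
      ∑' n : ℤ, ‖fiberScale • h (n + θ / (2 * Real.pi))‖ₑ ^ (2 : ℝ) := by
    refine Measurable.tsum fun n => ?_
    have : StronglyMeasurable fun θ : ℝ => fiberScale • h (n + θ / (2 * Real.pi)) :=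
      ((Lp.stronglyMeasurable h).comp_measurable (by fun_prop)).const_smul fiberScale
    exact this.enorm.pow_const _
  filter_upwards [ae_lt_top hmeas hfin] with θ hθ n
  have := memℓp_two_of_tsum_lt_top _ hθ
  rw [fiberFun, dif_pos this]

theorem aestronglyMeasurable_fiberFun (h : L2R H) :
    AEStronglyMeasurable (fiberFun h) circleMeasure := by
  refine aestronglyMeasurable_of_tendsto_ae (Filter.atTop : Filter (Finset ℤ))
    (f := fun s θ => ∑ n ∈ s,
      lp.single (E := fun _ : ℤ => H) 2 n (fiberScale • h (n + θ / (2 * Real.pi)))) ?_ ?_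
  · intro s
    refine Finset.aestronglyMeasurable_fun_sum s fun n _ => ?_
    have : StronglyMeasurable fun θ : ℝ => fiberScale • h (n + θ / (2 * Real.pi)) :=
      ((Lp.stronglyMeasurable h).comp_measurable (by fun_prop)).const_smul fiberScale
    exact (lp.isometry_single n).continuous.comp_aestronglyMeasurable this.aestronglyMeasurable
  · filter_upwards [fiberFun_apply h] with θ hθ
    have := lp.hasSum_single (p := 2) (by norm_num) (fiberFun h θ)
    simp only [hθ] at this
    exact this

theorem lintegral_fiberFun (h : L2R H) :
    ∫⁻ θ, ‖fiberFun h θ‖ₑ ^ (2 : ℝ) ∂circleMeasure = ∫⁻ x, ‖h x‖ₑ ^ (2 : ℝ) := by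
  rw [← lintegral_fibers _ (Lp.stronglyMeasurable h)]
  refine lintegral_congr_ae ?_
  filter_upwards [fiberFun_apply h] with θ hθ
  rw [enorm_sq_ell2]
  exact tsum_congr fun n => by rw [hθ n]

theorem eLpNorm_two_eq {α G : Type*} [MeasurableSpace α] {μ : Measure α}
    [NormedAddCommGroup G] (f : α → G) :
    eLpNorm f 2 μ = (∫⁻ x, ‖f x‖ₑ ^ (2 : ℝ) ∂μ) ^ (1 / (2 : ℝ)) := by
  rw [eLpNorm_eq_lintegral_rpow_enorm_toReal (by norm_num) (by norm_num)]
  norm_num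

theorem eLpNorm_fiberFun (h : L2R H) :
    eLpNorm (fiberFun h) 2 circleMeasure = eLpNorm h 2 volume := by
  rw [eLpNorm_two_eq, eLpNorm_two_eq, lintegral_fiberFun]

theorem memLp_fiberFun (h : L2R H) : MemLp (fiberFun h) 2 circleMeasure :=
  ⟨aestronglyMeasurable_fiberFun h, by rw [eLpNorm_fiberFun]; exact (Lp.memLp h).2⟩

/-- The isometry `h ↦ (θ ↦ (n ↦ (2π)^(-1/2) h (n + θ / 2π)))`. -/
def fiberIsometry : L2R H →ₗᵢ[ℂ] L2Ell2 H where
  toFun h := (memLp_fiberFun h).toLp (fiberFun h)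
  map_add' f g := by
    rw [← MemLp.toLp_add]
    refine MemLp.toLp_congr _ _ ?_
    filter_upwards [fiberFun_apply f, fiberFun_apply g, fiberFun_apply (f + g),
      ae_fibers (Lp.coeFn_add f g)] with θ h1 h2 h3 h4
    refine lp.ext ?_
    funext n
    rw [h3 n, h4 n, Pi.add_apply, Pi.add_apply, lp.coeFn_add, Pi.add_apply, h1 n, h2 n, smul_add]
  map_smul' c f := by
    rw [RingHom.id_apply, ← MemLp.toLp_const_smul]
    refine MemLp.toLp_congr _ _ ?_
    filter_upwards [fiberFun_apply f, fiberFun_apply (c • f),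
      ae_fibers (Lp.coeFn_smul c f)] with θ h1 h2 h3
    refine lp.ext ?_
    funext n
    rw [h2 n, h3 n, Pi.smul_apply, Pi.smul_apply, lp.coeFn_smul, Pi.smul_apply, h1 n, smul_comm]
  norm_map' h := by
    change ‖(memLp_fiberFun h).toLp (fiberFun h)‖ = ‖h‖
    rw [Lp.norm_toLp, eLpNorm_fiberFun, Lp.norm_def]

theorem fiberIsometry_apply (h : L2R H) :
    ∀ᵐ θ ∂circleMeasure, ∀ n : ℤ,
      fiberIsometry h θ n = fiberScale • h (n + θ / (2 * Real.pi)) := by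
  filter_upwards [fiberFun_apply h, (memLp_fiberFun h).coeFn_toLp] with θ h1 h2 n
  rw [← h1 n, ← h2]
  rfl

/-- The function on `ℝ` with fibers `g`. -/
def unfiber (g : ℝ → Ell2 H) (x : ℝ) : H :=
  fiberScale⁻¹ • g (2 * Real.pi * Int.fract x) ⌊x⌋

theorem unfiber_apply (g : ℝ → Ell2 H) (n : ℤ) {θ : ℝ} (hθ : θ ∈ Set.Ioo 0 (2 * Real.pi)) :
    fiberScale • unfiber g (n + θ / (2 * Real.pi)) = g θ n := by
  have hpi : 0 < 2 * Real.pi := by positivity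
  have h3 : 0 ≤ θ / (2 * Real.pi) := div_nonneg hθ.1.le hpi.le
  have h4 : θ / (2 * Real.pi) < 1 := (div_lt_one hpi).2 hθ.2
  have hfl : ⌊θ / (2 * Real.pi)⌋ = 0 := Int.floor_eq_zero_iff.2 ⟨h3, h4⟩
  have hfr : 2 * Real.pi * (θ / (2 * Real.pi)) = θ := by field_simp
  rw [unfiber, smul_smul, mul_inv_cancel₀ fiberScale_ne_zero, one_smul, Int.fract_intCast_add,
    Int.floor_intCast_add, hfl, add_zero, Int.fract_eq_self.2 ⟨h3, h4⟩, hfr]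

theorem stronglyMeasurable_unfiber (g : ℝ → Ell2 H) (hg : StronglyMeasurable g) :
    StronglyMeasurable (unfiber g) := by
  have h1 : StronglyMeasurable fun p : ℝ × ℤ => g (2 * Real.pi * Int.fract p.1) p.2 := by
    have h2 : ∀ n : ℤ, StronglyMeasurable fun x : ℝ => g (2 * Real.pi * Int.fract x) n := by
      intro n
      have hc : Continuous fun y : Ell2 H => y n := (lp.evalCLM ℂ (fun _ : ℤ => H) 2 n).continuous
      exact hc.comp_stronglyMeasurable
        (hg.comp_measurable (measurable_fract.const_mul (2 * Real.pi)))
    borelize H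
    rw [stronglyMeasurable_iff_measurable_separable]
    constructor
    · exact measurable_from_prod_countable_left fun n => (h2 n).measurable
    · have : Set.range (fun p : ℝ × ℤ => g (2 * Real.pi * Int.fract p.1) p.2) ⊆
          ⋃ n : ℤ, Set.range fun x : ℝ => g (2 * Real.pi * Int.fract x) n := by
        rintro _ ⟨⟨x, n⟩, rfl⟩
        exact Set.mem_iUnion.2 ⟨n, x, rfl⟩
      exact (TopologicalSpace.IsSeparable.iUnion fun n => (h2 n).isSeparable_range).mono this
  exact (h1.comp_measurable (measurable_id.prodMk Int.measurable_floor)).const_smul _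

theorem memLp_unfiber (g : L2Ell2 H) : MemLp (unfiber g) 2 (volume : Measure ℝ) := by
  have hm := stronglyMeasurable_unfiber g (Lp.stronglyMeasurable g)
  refine ⟨hm.aestronglyMeasurable, ?_⟩
  have : ∫⁻ x, ‖unfiber g x‖ₑ ^ (2 : ℝ) = ∫⁻ θ, ‖g θ‖ₑ ^ (2 : ℝ) ∂circleMeasure := by
    rw [← lintegral_fibers _ hm]
    refine setLIntegral_congr_fun measurableSet_Ioo fun θ hθ => ?_
    rw [enorm_sq_ell2]
    exact tsum_congr fun n => by rw [unfiber_apply g n hθ]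
  rw [eLpNorm_two_eq, this, ← eLpNorm_two_eq]
  exact (Lp.memLp g).2

theorem fiberIsometry_surjective : Function.Surjective (fiberIsometry (H := H)) := by
  intro g
  refine ⟨(memLp_unfiber g).toLp _, ?_⟩
  refine Lp.ext ?_
  filter_upwards [fiberIsometry_apply ((memLp_unfiber g).toLp _),
    ae_fibers (memLp_unfiber g).coeFn_toLp, ae_restrict_mem measurableSet_Ioo] with θ h1 h2 hθ
  refine lp.ext ?_
  funext n
  rw [h1 n, h2 n, unfiber_apply g n hθ]

variable [CompleteSpace H]

/-- The Floquet–Bloch transform `(𝒯 f)(θ)_n = f̂ (2πn + θ)`, where `f̂` is the unitary Fourier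
transform `f̂ k = (2π)^(-1/2) ∫ exp(-ikt) f t dt` on `L²(ℝ; H)`. In terms of the Fourier transform
`𝓕 f ξ = ∫ exp(-2πiξt) f t dt` used here, `f̂ k = (2π)^(-1/2) 𝓕 f (k / 2π)`. -/
def floquetTransform : L2R H ≃ₗᵢ[ℂ] L2Ell2 H :=
  (Lp.fourierTransformₗᵢ ℝ H).trans
    (LinearIsometryEquiv.ofSurjective fiberIsometry fiberIsometry_surjective)

/-- The formula `(𝒯 f)(θ)_n = (2π)^(-1/2) 𝓕 f ((2πn + θ) / 2π)`. -/
theorem floquetTransform_apply (f : L2R H) :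
    ∀ᵐ θ ∂circleMeasure, ∀ n : ℤ, floquetTransform f θ n =
      fiberScale • (𝓕 f : L2R H) ((2 * Real.pi * n + θ) / (2 * Real.pi)) := by
  filter_upwards [fiberIsometry_apply (𝓕 f : L2R H)] with θ h n
  have hpi : 2 * Real.pi ≠ 0 := by positivity
  rw [add_div, mul_div_cancel_left₀ _ hpi]
  exact h n

/-- The multiplication operator `M(A + θ)` on `L²((0, 2π); ℓ²(H))`. -/
def fiberedOperator (A : Ell2 H →ₗ.[ℂ] Ell2 H) : L2Ell2 H →ₗ.[ℂ] L2Ell2 H :=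
  multiplication circleMeasure fun θ : ℝ => ((θ : ℂ) • (LinearMap.id : Ell2 H →ₗ[ℂ] Ell2 H)) +ᵥ A

end Fiber

end Floquet

end

open Floquet

open Filter Topology

noncomputable section

set_option linter.unusedSectionVars false

namespace Floquet

/-! ### Unitary groups and their generators: symmetry, self-adjointness, uniqueness -/

section Stone

variable {E : Type*} [NormedAddCommGroup E] [InnerProductSpace ℂ E]

local notation "⟪" x ", " y "⟫" => inner ℂ x y

/-! The transform $\mathcal T$ turns every operator in the problem into an explicit one on fibers.
Translation $T_\sigma$ becomes $e^{-i\sigma\theta}D_\sigma$, with the constant diagonal unitary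
$D_\sigma=\mathrm{diag}(e^{-2\pi i\sigma n})$; in particular $T_1$ is multiplication by
$e^{-i\theta}$. Multiplication by $e^{iat}$ becomes translation by $a$ of the variable $2\pi
n+\theta$, that is, translation in $\theta$ with a carry into $n$; for $a=2\pi$ only the carry is
left, and it is $S$ on each fiber.

Let $U_\sigma=e^{-i\sigma K}$ be an evolution group of period $1$. Then $W_\sigma=U_\sigma
T_\sigma^*$ commutes with $T_1$ and with all $e^{iat}$. On the fiber side it commutes with all
$e^{in\theta}$, hence with $L^\infty(0,2\pi)$, and with the translations, so it maps constant
functions to constant functions. It is therefore one unitary $w_\sigma$ applied in every fiber, and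
$a=2\pi$ shows that $w_\sigma$ commutes with $S$ (`exists_constOp_of_comm`). So $U_\sigma$ becomes
$e^{-i\sigma\theta}V_\sigma$ with $V_\sigma=w_\sigma D_\sigma$. These $V_\sigma$ form a strongly
continuous group, and $SD_\sigma=e^{2\pi i\sigma}D_\sigma S$ gives $(*)$. The operator $\tilde K$ is
the generator of $V$; uniqueness follows by testing on constant functions.

Conversely, given $\tilde K$, Stone's theorem supplies $V_\sigma$, and $(*)$ says that $V_\sigma
D_\sigma^*$ commutes with $S$. As a constant operator it then commutes with the fiber translations
by $a\in(0,2\pi]$; these parameters generate $\mathbb R$, and the functions $e^{iat}$ separate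
$L^1$, so $W_\sigma$ commutes with every $M(\phi)$.

Two analytic facts carry the unbounded operators: Stone's theorem in both directions
(`IsGeneratorOf.isSelfAdjoint`, `exists_isGeneratorOf`), and `isGeneratorOf_fiberGroup`, which
identifies the generator of $e^{-i\sigma\theta}V_\sigma$ with $M(\tilde K+\theta)$, domain included.
-/

theorem mem_graph_iff_of_isSelfAdjoint [CompleteSpace E] {A : E →ₗ.[ℂ] E} (hA : IsSelfAdjoint A)
    {z w : E} : (z, w) ∈ A.graph ↔ ∀ x y, (x, y) ∈ A.graph → ⟪y, z⟫ = ⟪x, w⟫ := by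
  have h := LinearPMap.adjoint_graph_eq_graph_adjoint hA.dense_domain
  rw [LinearPMap.isSelfAdjoint_def.1 hA] at h
  conv_lhs => rw [h]
  simp [Submodule.mem_adjoint_iff, sub_eq_zero, -LinearPMap.mem_graph_iff]

theorem isSelfAdjoint_of_mem_graph_iff [CompleteSpace E] {A : E →ₗ.[ℂ] E}
    (hd : Dense (A.domain : Set E))
    (h : ∀ z w, (z, w) ∈ A.graph ↔ ∀ x y, (x, y) ∈ A.graph → ⟪y, z⟫ = ⟪x, w⟫) :
    IsSelfAdjoint A := by
  rw [LinearPMap.isSelfAdjoint_def]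
  refine LinearPMap.eq_of_eq_graph ?_
  rw [LinearPMap.adjoint_graph_eq_graph_adjoint hd]
  ext ⟨z, w⟩
  rw [h]
  simp [Submodule.mem_adjoint_iff, sub_eq_zero, -LinearPMap.mem_graph_iff]

theorem eq_of_mem_graph_iff {F : Type*} [NormedAddCommGroup F] [InnerProductSpace ℂ F]
    {A B : E →ₗ.[ℂ] F} (h : ∀ x y, (x, y) ∈ A.graph ↔ (x, y) ∈ B.graph) : A = B :=
  LinearPMap.eq_of_eq_graph (Submodule.ext fun ⟨x, y⟩ => h x y)

theorem dense_domain_induction {A : E →ₗ.[ℂ] E} (hd : Dense (A.domain : Set E)) {p : E → Prop}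
    (hp : IsClosed {x | p x}) (h : ∀ x y, (x, y) ∈ A.graph → p x) (x : E) : p x := by
  have h1 : (A.domain : Set E) ⊆ {x | p x} := fun x hx => by
    obtain ⟨y, hy⟩ := LinearPMap.mem_domain_iff.1 hx
    exact h x y hy
  have h2 := hp.closure_subset_iff.2 h1
  rw [hd.closure_eq] at h2
  exact h2 (Set.mem_univ x)

theorem hasDerivAt_comp_isometryEquiv {F : Type*} [NormedAddCommGroup F] [InnerProductSpace ℂ F]
    (T : E ≃ₗᵢ[ℂ] F) {u : ℝ → E} {u' : E} {t : ℝ} (h : HasDerivAt u u' t) :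
    HasDerivAt (fun s => T (u s)) (T u') t :=
  (T.toContinuousLinearEquiv.toContinuousLinearMap.restrictScalars ℝ).hasFDerivAt.comp_hasDerivAt
    t h

namespace UnitaryGroup

variable (U : UnitaryGroup E)

theorem zero_apply (x : E) : U.toFun 0 x = x := by
  have h := U.map_add 0 0 x
  rw [add_zero] at h
  exact ((U.toFun 0).injective h).symm

theorem neg_apply_apply (s : ℝ) (x : E) : U.toFun (-s) (U.toFun s x) = x := by
  rw [← U.map_add, neg_add_cancel, U.zero_apply]

theorem apply_neg_apply (s : ℝ) (x : E) : U.toFun s (U.toFun (-s) x) = x := by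
  rw [← U.map_add, add_neg_cancel, U.zero_apply]

theorem inner_apply_left (s : ℝ) (x y : E) : ⟪U.toFun s x, y⟫ = ⟪x, U.toFun (-s) y⟫ := by
  conv_lhs => rw [← U.apply_neg_apply s y]
  exact (U.toFun s).inner_map_map _ _

@[ext]
theorem ext {U V : UnitaryGroup E} (h : ∀ s x, U.toFun s x = V.toFun s x) : U = V := by
  obtain ⟨u, _, _⟩ := U
  obtain ⟨v, _, _⟩ := V
  have : u = v := funext fun s => LinearIsometryEquiv.ext (h s)
  subst this
  rfl

/-- Differentiability is transported from $0$ to $t$ by $U_s=U_tU_{s-t}$. -/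
theorem hasDerivAt {x y : E} (h : HasDerivAt (fun s => U.toFun s x) y 0) (t : ℝ) :
    HasDerivAt (fun s => U.toFun s x) (U.toFun t y) t := by
  have h1 : HasDerivAt (fun s => U.toFun (s - t) x) y t := by
    have h0 : HasDerivAt (fun s => U.toFun s x) y (t - t) := by rwa [sub_self]
    exact HasDerivAt.comp_sub_const t t h0
  have h2 := hasDerivAt_comp_isometryEquiv (U.toFun t) h1
  refine h2.congr_of_eventuallyEq (Eventually.of_forall fun s => ?_)
  change U.toFun s x = U.toFun t (U.toFun (s - t) x)
  rw [← U.map_add, add_sub_cancel]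

theorem hasDerivAt_neg {x y : E} (h : HasDerivAt (fun s => U.toFun s x) y 0) (t : ℝ) :
    HasDerivAt (fun s => U.toFun (-s) x) (-U.toFun (-t) y) t := by
  have := (U.hasDerivAt h (-t)).scomp t (_root_.hasDerivAt_neg t)
  rwa [neg_one_smul] at this

/-- Mean value inequality: the derivative $U_sy$ of the orbit has constant norm. -/
theorem norm_apply_sub_le {x y : E} (h : HasDerivAt (fun s => U.toFun s x) y 0) (t : ℝ) :
    ‖U.toFun t x - x‖ ≤ |t| * ‖y‖ := by
  have h1 := convex_univ.norm_image_sub_le_of_norm_hasDerivWithin_le (C := ‖y‖)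
    (f := fun s => U.toFun s x) (f' := fun s => U.toFun s y) (x := 0) (y := t)
    (fun s _ => (U.hasDerivAt h s).hasDerivWithinAt)
    (fun s _ => ((U.toFun s).norm_map y).le) (Set.mem_univ _) (Set.mem_univ _)
  simp only [U.zero_apply, sub_zero, Real.norm_eq_abs] at h1
  linarith

/-- The graph of the generator. -/
def generatorGraph : Submodule ℂ (E × E) where
  carrier := {p | HasDerivAt (fun s => U.toFun s p.1) (-(Complex.I • p.2)) 0}
  add_mem' := by
    rintro ⟨x, y⟩ ⟨x', y'⟩ h h'
    simp only [Set.mem_ofPred_eq] at *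
    convert HasDerivAt.add h h' using 1
    · funext s
      simp
    · simp [add_comm]
  zero_mem' := by
    simpa using hasDerivAt_const (0 : ℝ) (0 : E)
  smul_mem' := by
    rintro c ⟨x, y⟩ h
    simp only [Set.mem_ofPred_eq, Prod.smul_mk] at *
    convert HasDerivAt.const_smul c h using 1
    · funext s
      simp
    · rw [smul_neg, smul_comm]

/-- The generator of a unitary group. -/
def generator : E →ₗ.[ℂ] E := U.generatorGraph.toLinearPMap

theorem isGeneratorOf_generator : IsGeneratorOf U.generator U := by
  intro x y
  unfold generator
  rw [Submodule.toLinearPMap_graph_eq]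
  · rfl
  · rintro ⟨x, y⟩ h hx
    have h' : HasDerivAt (fun s => U.toFun s x) (-(Complex.I • y)) 0 := h
    simp only at hx ⊢
    subst hx
    simp only [map_zero] at h'
    simpa using h'.unique (hasDerivAt_const _ _)

end UnitaryGroup

theorem IsGeneratorOf.eq {K L : E →ₗ.[ℂ] E} {U : UnitaryGroup E} (hK : IsGeneratorOf K U)
    (hL : IsGeneratorOf L U) : K = L :=
  eq_of_mem_graph_iff fun x y => (hK x y).trans (hL x y).symm

namespace IsGeneratorOf

variable {K : E →ₗ.[ℂ] E} {U : UnitaryGroup E} (hK : IsGeneratorOf K U)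
include hK

theorem apply_mem_graph {x y : E} (h : (x, y) ∈ K.graph) (s : ℝ) :
    (U.toFun s x, U.toFun s y) ∈ K.graph := by
  rw [hK] at h ⊢
  have := U.hasDerivAt h s
  have h1 : HasDerivAt (fun t => U.toFun (s + t) x) (U.toFun s (-(Complex.I • y))) 0 := by
    have h0 : HasDerivAt (fun s => U.toFun s x) (U.toFun s (-(Complex.I • y))) (s + 0) := by
      rwa [add_zero]
    exact HasDerivAt.comp_const_add s 0 h0
  rw [map_neg, map_smul] at h1
  refine h1.congr_of_eventuallyEq (Eventually.of_forall fun t => ?_)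
  change U.toFun t (U.toFun s x) = _
  rw [← U.map_add, add_comm]

theorem hasDerivAt {x y : E} (h : (x, y) ∈ K.graph) (t : ℝ) :
    HasDerivAt (fun s => U.toFun s x) (-(Complex.I • U.toFun t y)) t := by
  simpa using U.hasDerivAt ((hK x y).1 h) t

/-- Differentiate the constant function $t\mapsto\langle U_tx,U_tx'\rangle$ at $0$. -/
theorem inner_comm {x y x' y' : E} (h : (x, y) ∈ K.graph) (h' : (x', y') ∈ K.graph) :
    ⟪y, x'⟫ = ⟪x, y'⟫ := by
  have h1 := HasDerivAt.inner ℂ ((hK x y).1 h) ((hK x' y').1 h')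
  have h2 : (fun t => ⟪U.toFun t x, U.toFun t x'⟫) = fun _ => ⟪x, x'⟫ :=
    funext fun t => (U.toFun t).inner_map_map x x'
  rw [h2] at h1
  have h3 := (hasDerivAt_const (0 : ℝ) ⟪x, x'⟫).unique h1
  simp only [U.zero_apply, inner_neg_right, inner_neg_left, inner_smul_left, inner_smul_right,
    Complex.conj_I, neg_mul, neg_neg] at h3
  have h4 : Complex.I * (⟪y, x'⟫ - ⟪x, y'⟫) = 0 := by
    rw [mul_sub, h3]
    ring
  simpa [sub_eq_zero] using h4

/-- Uniqueness for the Schrödinger equation `i u' = K u`. -/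
theorem schrodinger_unique {u u' v v' : ℝ → E}
    (hu : ∀ s, HasDerivAt u (-(Complex.I • u' s)) s) (hu' : ∀ s, (u s, u' s) ∈ K.graph)
    (hv : ∀ s, HasDerivAt v (-(Complex.I • v' s)) s) (hv' : ∀ s, (v s, v' s) ∈ K.graph)
    (h0 : u 0 = v 0) : u = v := by
  have hw : ∀ s, HasDerivAt (u - v) (-(Complex.I • (u' s - v' s))) s := fun s => by
    convert (hu s).sub (hv s) using 1
    rw [smul_sub]
    abel
  have hg : ∀ s, ((u - v) s, u' s - v' s) ∈ K.graph := fun s => K.graph.sub_mem (hu' s) (hv' s)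
  -- By symmetry of $K$ the squared norm of the difference of two solutions is conserved.
  have hd : ∀ s, HasDerivAt (fun t => ⟪(u - v) t, (u - v) t⟫) 0 s := fun s => by
    have h1 := HasDerivAt.inner ℂ (hw s) (hw s)
    have h2 : ⟪(u - v) s, -(Complex.I • (u' s - v' s))⟫ + ⟪-(Complex.I • (u' s - v' s)), (u - v) s⟫
        = 0 := by
      rw [inner_neg_right, inner_neg_left, inner_smul_left, inner_smul_right, Complex.conj_I,
        hK.inner_comm (hg s) (hg s)]
      ring
    rwa [h2] at h1
  have hc := is_const_of_deriv_eq_zero (fun s => (hd s).differentiableAt) fun s => (hd s).deriv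
  funext s
  have h1 : ⟪(u - v) s, (u - v) s⟫ = ⟪(u - v) 0, (u - v) 0⟫ := hc s 0
  have h2 : (u - v) 0 = 0 := by simp [h0]
  rw [h2, inner_zero_left, inner_self_eq_zero] at h1
  exact sub_eq_zero.1 h1

variable [CompleteSpace E]

/-- The integrals $G(t)=\int_0^tU_rx\,dr$ lie in the domain, and $G(t)/t\to x$. -/
theorem dense_domain : Dense (K.domain : Set E) := by
  intro x
  have hcont := U.strongly_continuous x
  set G : ℝ → E := fun t => ∫ r in (0 : ℝ)..t, U.toFun r x with hG
  have hGd : ∀ t, HasDerivAt G (U.toFun t x) t := fun t =>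
    intervalIntegral.integral_hasDerivAt_right (hcont.intervalIntegrable _ _)
      hcont.stronglyMeasurable.stronglyMeasurableAtFilter hcont.continuousAt
  have hUG : ∀ s t, U.toFun s (G t) = G (s + t) - G s := by
    intro s t
    have h1 : U.toFun s (G t) = ∫ r in (0 : ℝ)..t, U.toFun s (U.toFun r x) :=
      ((U.toFun s).toContinuousLinearEquiv.toContinuousLinearMap.intervalIntegral_comp_comm
        (hcont.intervalIntegrable _ _)).symm
    rw [h1, hG]
    simp only [← U.map_add]
    rw [intervalIntegral.integral_interval_sub_left (hcont.intervalIntegrable _ _)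
      (hcont.intervalIntegrable _ _), intervalIntegral.integral_comp_add_left
      (fun r => U.toFun r x), add_zero]
  have hmem : ∀ t, G t ∈ K.domain := by
    intro t
    -- Since $U_sG(t)=G(s+t)-G(s)$, the derivative at $s=0$ is $U_tx-x$, which must equal $-i$ times
    -- the image.
    refine LinearPMap.mem_domain_of_mem_graph (y := Complex.I • (U.toFun t x - x)) ?_
    rw [hK]
    have h1 : HasDerivAt (fun s => G (s + t)) (U.toFun (0 + t) x) 0 :=
      HasDerivAt.comp_add_const 0 t (hGd (0 + t))
    have h2 := h1.sub (hGd 0)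
    rw [zero_add, U.zero_apply] at h2
    have h3 : -(Complex.I • Complex.I • (U.toFun t x - x)) = U.toFun t x - x := by
      rw [smul_smul, Complex.I_mul_I, neg_one_smul, neg_neg]
    rw [h3]
    exact h2.congr_of_eventuallyEq (Eventually.of_forall fun s => hUG s t)
  have h0 : Tendsto (fun t : ℝ => t⁻¹ • G t) (𝓝[≠] 0) (𝓝 x) := by
    have h1 := (hGd 0).tendsto_slope_zero
    simpa [hG, U.zero_apply] using h1
  refine mem_closure_of_tendsto h0 (Eventually.of_forall fun t => ?_)
  have := K.domain.smul_mem ((t⁻¹ : ℝ) : ℂ) (hmem t)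
  rwa [Complex.coe_smul] at this

/-- One inclusion is symmetry. For the other, if $(z,w)$ is in the graph of the adjoint, then
$U_tz=z-i\int_0^tU_rw\,dr$: both sides have the same inner products with domain vectors, as the
derivatives in $t$ agree. Hence the orbit of $z$ has derivative $-iw$ at $0$. -/
theorem isSelfAdjoint : IsSelfAdjoint K := by
  refine isSelfAdjoint_of_mem_graph_iff hK.dense_domain fun z w => ⟨fun h x y hxy =>
    hK.inner_comm hxy h, fun h => ?_⟩
  rw [hK]
  have hcont : Continuous fun r => -(Complex.I • U.toFun r w) :=
    ((U.strongly_continuous w).const_smul Complex.I).neg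
  set G : ℝ → E := fun t => ∫ r in (0 : ℝ)..t, -(Complex.I • U.toFun r w) with hG
  have hGd : ∀ t, HasDerivAt G (-(Complex.I • U.toFun t w)) t := fun t =>
    intervalIntegral.integral_hasDerivAt_right (hcont.intervalIntegrable _ _)
      hcont.stronglyMeasurable.stronglyMeasurableAtFilter hcont.continuousAt
  have key : ∀ t, U.toFun t z = z + G t := by
    intro t
    refine hK.dense_domain.eq_of_inner_right ℂ fun x hx => ?_
    obtain ⟨y, hxy⟩ := LinearPMap.mem_domain_iff.1 hx
    have hd : ∀ s, HasDerivAt (fun s => ⟪x, U.toFun s z⟫ - ⟪x, z + G s⟫) 0 s := by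
      intro s
      have h1 : HasDerivAt (fun s => ⟪x, U.toFun s z⟫) ⟪x, -(Complex.I • U.toFun s w)⟫ s := by
        have h2 := HasDerivAt.inner ℂ (U.hasDerivAt_neg ((hK x y).1 hxy) s)
          (hasDerivAt_const s z)
        have h3 : ⟪U.toFun (-s) x, (0 : E)⟫ + ⟪-U.toFun (-s) (-(Complex.I • y)), z⟫ =
            ⟪x, -(Complex.I • U.toFun s w)⟫ := by
          have h4 := h _ _ (hK.apply_mem_graph hxy (-s))
          have h5 := U.inner_apply_left (-s) x w
          rw [neg_neg] at h5
          rw [inner_zero_right, zero_add, map_neg, neg_neg, map_smul, inner_smul_left, h4, h5,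
            inner_neg_right, inner_smul_right, Complex.conj_I, neg_mul]
        rw [h3] at h2
        refine h2.congr_of_eventuallyEq (Eventually.of_forall fun s => ?_)
        change _ = ⟪U.toFun (-s) x, z⟫
        rw [U.inner_apply_left, neg_neg]
      have h2 : HasDerivAt (fun s => ⟪x, z + G s⟫) ⟪x, -(Complex.I • U.toFun s w)⟫ s := by
        have h3 := HasDerivAt.inner ℂ (hasDerivAt_const s x) ((hGd s).const_add z)
        rwa [inner_zero_left, add_zero] at h3
      have h3 := h1.sub h2
      rwa [sub_self] at h3
    have hc := is_const_of_deriv_eq_zero (fun s => (hd s).differentiableAt)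
      (fun s => (hd s).deriv) t 0
    have hG0 : G 0 = 0 := intervalIntegral.integral_same
    simp only [U.zero_apply, hG0, add_zero, sub_self] at hc
    exact sub_eq_zero.1 hc
  have h1 : (fun s => U.toFun s z) = fun s => z + G s := funext key
  rw [h1]
  simpa [U.zero_apply] using (hGd 0).const_add z

theorem group_unique {V : UnitaryGroup E} (hV : IsGeneratorOf K V) : U = V := by
  refine UnitaryGroup.ext fun s => dense_domain_induction hK.dense_domain
    (isClosed_eq (U.toFun s).continuous (V.toFun s).continuous) fun x y hxy => ?_
  refine congrFun (hK.schrodinger_unique (fun t => hK.hasDerivAt hxy t)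
    (fun t => hK.apply_mem_graph hxy t) (fun t => hV.hasDerivAt hxy t)
    (fun t => hV.apply_mem_graph hxy t) ?_) s
  rw [U.zero_apply, V.zero_apply]

/-- For $x$ in the domain, $U_sTx$ and $TU_sx$ solve the same Schrödinger equation with the same
initial value. Conversely, $T$ is applied to the difference quotients. -/
theorem commutesWith_iff {T : E ≃ₗᵢ[ℂ] E} :
    CommutesWith K T ↔ ∀ s x, U.toFun s (T x) = T (U.toFun s x) := by
  constructor
  · intro h s
    refine dense_domain_induction hK.dense_domain
      (isClosed_eq ((U.toFun s).continuous.comp T.continuous)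
        (T.continuous.comp (U.toFun s).continuous)) fun x y hxy => ?_
    refine congrFun (hK.schrodinger_unique (u := fun s => U.toFun s (T x))
      (v := fun s => T (U.toFun s x)) (fun t => hK.hasDerivAt (h _ _ hxy) t)
      (fun t => hK.apply_mem_graph (h _ _ hxy) t) (v' := fun t => T (U.toFun t y)) (fun t => ?_)
      (fun t => h _ _ (hK.apply_mem_graph hxy t)) ?_) s
    · have := hasDerivAt_comp_isometryEquiv T (hK.hasDerivAt hxy t)
      rwa [map_neg, map_smul] at this
    · simp only [U.zero_apply]
  · intro h x y hxy
    rw [hK] at hxy ⊢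
    have := hasDerivAt_comp_isometryEquiv T hxy
    rw [map_neg, map_smul] at this
    exact this.congr_of_eventuallyEq (Eventually.of_forall fun s => h s x)

/-- Uniqueness of the group makes the choice in `expNegI` harmless. -/
theorem expNegI_eq (s : ℝ) : expNegI K s = U.toFun s := by
  have h : ∃ V : UnitaryGroup E, IsGeneratorOf K V := ⟨U, hK⟩
  rw [expNegI, dif_pos h, hK.group_unique h.choose_spec]

end IsGeneratorOf

end Stone

/-! ### Stone's theorem: existence of the group -/

section StoneExistence

variable {E : Type*} [NormedAddCommGroup E] [InnerProductSpace ℂ E] [CompleteSpace E]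

local notation "⟪" x ", " y "⟫" => inner ℂ x y

/-- The bounded self-adjoint operator `-tB`. -/
def negSMul (B : selfAdjoint (E →L[ℂ] E)) (t : ℝ) : selfAdjoint (E →L[ℂ] E) :=
  ⟨-((t : ℂ) • (B : E →L[ℂ] E)), by
    have h : IsSelfAdjoint (t : ℂ) := Complex.conj_ofReal t
    exact (h.smul B.2).neg⟩

theorem commute_negSMul {A B : selfAdjoint (E →L[ℂ] E)}
    (h : Commute (A : E →L[ℂ] E) (B : E →L[ℂ] E)) (s t : ℝ) :
    Commute (negSMul A s : E →L[ℂ] E) (negSMul B t : E →L[ℂ] E) :=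
  ((((h.smul_left (s : ℂ)).smul_right (t : ℂ)).neg_left).neg_right)

/-- The unitary operator `exp (-itB)` for bounded self-adjoint `B`. -/
def expUnitaryEquiv (B : selfAdjoint (E →L[ℂ] E)) : E ≃ₗᵢ[ℂ] E :=
  Unitary.linearIsometryEquiv (selfAdjoint.expUnitary B)

theorem expUnitaryEquiv_add {A B : selfAdjoint (E →L[ℂ] E)}
    (h : Commute (A : E →L[ℂ] E) (B : E →L[ℂ] E)) (x : E) :
    expUnitaryEquiv (A + B) x = expUnitaryEquiv A (expUnitaryEquiv B x) := by
  rw [expUnitaryEquiv, h.expUnitary_add, map_mul]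
  rfl

/-- The group `exp (-itB)` for bounded self-adjoint `B`. -/
def boundedGroup (B : selfAdjoint (E →L[ℂ] E)) : UnitaryGroup E where
  toFun t := expUnitaryEquiv (negSMul B t)
  map_add s t x := by
    have h : negSMul B (s + t) = negSMul B s + negSMul B t := Subtype.ext (by
      change -(((s + t : ℝ) : ℂ) • (B : E →L[ℂ] E)) = -((s : ℂ) • (B : E →L[ℂ] E)) +
        -((t : ℂ) • (B : E →L[ℂ] E))
      rw [Complex.ofReal_add, add_smul, neg_add])
    have hc : Commute (negSMul B s : E →L[ℂ] E) (negSMul B t : E →L[ℂ] E) :=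
      commute_negSMul (Commute.refl _) s t
    rw [h, expUnitaryEquiv_add hc]
  strongly_continuous x := by
    have h0 : Continuous fun t : ℝ => negSMul B t := by
      refine Continuous.subtype_mk ?_ _
      exact (Complex.continuous_ofReal.smul continuous_const).neg
    have h : Continuous fun t : ℝ => (selfAdjoint.expUnitary (negSMul B t) : E →L[ℂ] E) :=
      continuous_subtype_val.comp (selfAdjoint.continuous_expUnitary.comp h0)
    exact h.clm_apply continuous_const

theorem boundedGroup_apply (B : selfAdjoint (E →L[ℂ] E)) (t : ℝ) (x : E) :
    (boundedGroup B).toFun t x =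
      NormedSpace.exp ((t : ℂ) • (-(Complex.I • (B : E →L[ℂ] E)))) x := by
  change NormedSpace.exp (Complex.I • (-((t : ℂ) • (B : E →L[ℂ] E)))) x = _
  rw [smul_neg, smul_neg, smul_comm]

theorem boundedGroup_hasDerivAt (B : selfAdjoint (E →L[ℂ] E)) (x : E) :
    HasDerivAt (fun t => (boundedGroup B).toFun t x)
      (-(Complex.I • (B : E →L[ℂ] E) x)) 0 := by
  have h := hasDerivAt_exp_smul_const (𝕂 := ℂ) (-(Complex.I • (B : E →L[ℂ] E)))
    ((0 : ℝ) : ℂ)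
  rw [Complex.ofReal_zero, zero_smul, NormedSpace.exp_zero, one_mul, ← Complex.ofReal_zero] at h
  have h1 := (h.clm_apply (hasDerivAt_const ((0 : ℝ) : ℂ) x)).scomp (0 : ℝ)
    Complex.ofRealCLM.hasDerivAt
  rw [map_zero, add_zero, Complex.ofRealCLM_apply, Complex.ofReal_one, one_smul] at h1
  exact h1.congr_of_eventuallyEq (Eventually.of_forall fun t => boundedGroup_apply B t x)

theorem boundedGroup_apply_sub_le (B : selfAdjoint (E →L[ℂ] E)) (t : ℝ) (x : E) :
    ‖(boundedGroup B).toFun t x - x‖ ≤ |t| * ‖(B : E →L[ℂ] E) x‖ := by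
  refine ((boundedGroup B).norm_apply_sub_le (boundedGroup_hasDerivAt B x) t).trans ?_
  rw [norm_neg, norm_smul, Complex.norm_I, one_mul]

/-- With $D=A-B$, which commutes with $B$, one has $e^{-itA}=e^{-itB}e^{-itD}$, so the difference
has the norm of $e^{-itD}x-x$. -/
theorem boundedGroup_sub_le {A B : selfAdjoint (E →L[ℂ] E)}
    (h : Commute (A : E →L[ℂ] E) (B : E →L[ℂ] E)) (t : ℝ) (x : E) :
    ‖(boundedGroup A).toFun t x - (boundedGroup B).toFun t x‖ ≤
      |t| * ‖(A : E →L[ℂ] E) x - (B : E →L[ℂ] E) x‖ := by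
  obtain ⟨D, hD⟩ : ∃ D : selfAdjoint (E →L[ℂ] E),
    (D : E →L[ℂ] E) = (A : E →L[ℂ] E) - (B : E →L[ℂ] E) := ⟨⟨_, A.2.sub B.2⟩, rfl⟩
  have hc : Commute (negSMul B t : E →L[ℂ] E) (negSMul D t : E →L[ℂ] E) :=
    commute_negSMul (by rw [hD]; exact h.symm.sub_right (Commute.refl _)) t t
  have h2 : negSMul A t = negSMul B t + negSMul D t := Subtype.ext (by
    change -((t : ℂ) • (A : E →L[ℂ] E)) = -((t : ℂ) • (B : E →L[ℂ] E)) +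
      -((t : ℂ) • (D : E →L[ℂ] E))
    rw [hD, smul_sub]
    abel)
  have h1 : (boundedGroup A).toFun t x =
      (boundedGroup B).toFun t ((boundedGroup D).toFun t x) := by
    change expUnitaryEquiv (negSMul A t) x = _
    rw [h2, expUnitaryEquiv_add hc]
    rfl
  have h3 : (A : E →L[ℂ] E) x - (B : E →L[ℂ] E) x = (D : E →L[ℂ] E) x := by rw [hD]; rfl
  rw [h1, ← map_sub, LinearIsometryEquiv.norm_map, h3]
  exact boundedGroup_apply_sub_le D t x

/-- An $\varepsilon/3$ argument: contractions that converge on a dense set converge everywhere. -/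
theorem cauchySeq_of_dense {A : E →ₗ.[ℂ] E} (hd : Dense (A.domain : Set E)) {F : ℕ → E → E}
    (hF : ∀ n x y, ‖F n x - F n y‖ ≤ ‖x - y‖)
    (h : ∀ x y, (x, y) ∈ A.graph → CauchySeq fun n => F n x) (x : E) :
    CauchySeq fun n => F n x := by
  rw [Metric.cauchySeq_iff]
  intro ε hε
  obtain ⟨z, hz, hxz⟩ := Metric.dense_iff.1 hd x (ε / 3) (by positivity)
  obtain ⟨w, hw⟩ := LinearPMap.mem_domain_iff.1 hxz
  obtain ⟨N, hN⟩ := Metric.cauchySeq_iff.1 (h z w hw) (ε / 3) (by positivity)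
  refine ⟨N, fun m hm n hn => ?_⟩
  rw [Metric.mem_ball, dist_eq_norm] at hz
  have h1 := hN m hm n hn
  have h2 := hF m x z
  have h3 := hF n z x
  rw [dist_eq_norm] at h1 ⊢
  rw [norm_sub_rev x z] at h2
  calc ‖F m x - F n x‖ = ‖(F m x - F m z) + (F m z - F n z) + (F n z - F n x)‖ := by abel_nf
    _ ≤ ‖F m x - F m z‖ + ‖F m z - F n z‖ + ‖F n z - F n x‖ := norm_add₃_le
    _ < ε := by linarith

/-- The limit of the groups generated by commuting bounded operators `B n` that converge strongly
to `A` on the domain of `A`. -/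
theorem exists_group_of_tendsto {A : E →ₗ.[ℂ] E} (hd : Dense (A.domain : Set E))
    {B : ℕ → selfAdjoint (E →L[ℂ] E)}
    (hc : ∀ m n, Commute (B m : E →L[ℂ] E) (B n : E →L[ℂ] E))
    (hB : ∀ x y, (x, y) ∈ A.graph → Tendsto (fun n => (B n : E →L[ℂ] E) x) atTop (𝓝 y)) :
    ∃ U : UnitaryGroup E, ∀ x y, (x, y) ∈ A.graph →
      HasDerivAt (fun s => U.toFun s x) (-(Complex.I • y)) 0 := by
  have hcau : ∀ t x, CauchySeq fun n => (boundedGroup (B n)).toFun t x := by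
    intro t
    refine cauchySeq_of_dense hd (fun n x y => ?_) fun x y hxy => ?_
    · rw [← map_sub, LinearIsometryEquiv.norm_map]
    · rw [Metric.cauchySeq_iff]
      intro ε hε
      obtain ⟨N, hN⟩ := Metric.cauchySeq_iff.1 (hB x y hxy).cauchySeq (ε / (|t| + 1))
        (by positivity)
      refine ⟨N, fun m hm n hn => ?_⟩
      have h1 := hN m hm n hn
      rw [dist_eq_norm] at h1 ⊢
      have h2 := boundedGroup_sub_le (hc m n) t x
      rw [lt_div_iff₀ (by positivity)] at h1
      nlinarith [norm_nonneg ((B m : E →L[ℂ] E) x - (B n : E →L[ℂ] E) x)]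
  choose L hL using fun t x => cauchySeq_tendsto_of_complete (hcau t x)
  have hnorm : ∀ t x, ‖L t x‖ = ‖x‖ := fun t x =>
    tendsto_nhds_unique (hL t x).norm (by simp)
  have hmap_add : ∀ t x y, L t (x + y) = L t x + L t y := fun t x y =>
    tendsto_nhds_unique (hL t (x + y)) (by simpa using (hL t x).add (hL t y))
  have hmap_smul : ∀ t (c : ℂ) x, L t (c • x) = c • L t x := fun t c x =>
    tendsto_nhds_unique (hL t (c • x)) (by simpa using (hL t x).const_smul c)
  have hmap_sub : ∀ t x y, L t (x - y) = L t x - L t y := fun t x y =>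
    tendsto_nhds_unique (hL t (x - y)) (by simpa using (hL t x).sub (hL t y))
  have hgroup : ∀ s t x, L (s + t) x = L s (L t x) := by
    intro s t x
    refine tendsto_nhds_unique (hL (s + t) x) ?_
    have h1 : Tendsto (fun n => (boundedGroup (B n)).toFun s
        ((boundedGroup (B n)).toFun t x - L t x)) atTop (𝓝 0) := by
      rw [tendsto_zero_iff_norm_tendsto_zero]
      simp only [LinearIsometryEquiv.norm_map]
      rw [← tendsto_zero_iff_norm_tendsto_zero]
      simpa using (hL t x).sub_const (L t x)
    have h2 := h1.add (hL s (L t x))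
    rw [zero_add] at h2
    refine h2.congr fun n => ?_
    rw [map_sub, sub_add_cancel, UnitaryGroup.map_add]
  have hzero : ∀ x, L 0 x = x := fun x =>
    tendsto_nhds_unique (hL 0 x) (by simp [UnitaryGroup.zero_apply])
  -- The bound for two approximants, with the second index sent to infinity.
  have happrox : ∀ x y, (x, y) ∈ A.graph → ∀ n t,
      ‖(boundedGroup (B n)).toFun t x - L t x‖ ≤ |t| * ‖(B n : E →L[ℂ] E) x - y‖ := by
    intro x y hxy n t
    refine le_of_tendsto_of_tendsto' ((hL t x).const_sub _).norm
      (((hB x y hxy).const_sub _).norm.const_mul |t|) fun m => ?_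
    exact boundedGroup_sub_le (hc n m) t x
  have hlip : ∀ x y, (x, y) ∈ A.graph → ∀ s t, ‖L t x - L s x‖ ≤ |t - s| * ‖y‖ := by
    intro x y hxy s t
    refine le_of_tendsto_of_tendsto' ((hL t x).sub (hL s x)).norm
      ((hB x y hxy).norm.const_mul |t - s|) fun n => ?_
    have h1 : (boundedGroup (B n)).toFun t x =
        (boundedGroup (B n)).toFun s ((boundedGroup (B n)).toFun (t - s) x) := by
      rw [← UnitaryGroup.map_add, add_sub_cancel]
    rw [h1, ← map_sub, LinearIsometryEquiv.norm_map]
    exact boundedGroup_apply_sub_le (B n) (t - s) x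
  have hcont : ∀ x, Continuous fun t => L t x := by
    intro x
    -- Orbits of domain vectors are Lipschitz, and they approximate the orbit of $x$ uniformly in
    -- time because each $L_t$ is isometric.
    refine continuous_of_uniform_approx_of_continuous fun u hu => ?_
    obtain ⟨ε, hε, hu⟩ := Metric.mem_uniformity_dist.1 hu
    obtain ⟨z, hz, hzd⟩ := Metric.dense_iff.1 hd x ε hε
    obtain ⟨w, hw⟩ := LinearPMap.mem_domain_iff.1 hzd
    refine ⟨fun t => L t z, ?_, fun t => hu ?_⟩
    · refine (LipschitzWith.of_dist_le_mul (K := ‖w‖₊) fun t s => ?_).continuous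
      rw [dist_eq_norm, Real.dist_eq, coe_nnnorm, mul_comm]
      exact hlip z w hw s t
    · rw [dist_eq_norm, ← hmap_sub, hnorm, ← dist_eq_norm, dist_comm]
      exact hz
  refine ⟨⟨fun t => ⟨⟨⟨⟨L t, hmap_add t⟩, hmap_smul t⟩, L (-t), fun x => ?_, fun x => ?_⟩,
    hnorm t⟩, hgroup, hcont⟩, fun x y hxy => ?_⟩
  · change L (-t) (L t x) = x
    rw [← hgroup, neg_add_cancel, hzero]
  · change L t (L (-t) x) = x
    rw [← hgroup, add_neg_cancel, hzero]
  · change HasDerivAt (fun s => L s x) _ 0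
    rw [hasDerivAt_iff_isLittleO_nhds_zero, Asymptotics.isLittleO_iff]
    intro c hc0
    -- With this one $N$ fixed, the error is at most $c|t|$: one third each from replacing $L_t$ by
    -- $e^{-itB_N}$, from differentiating the bounded group, and from replacing $B_Nx$ by $y$.
    obtain ⟨N, hN⟩ := Metric.tendsto_atTop.1 (hB x y hxy) (c / 3) (by positivity)
    have h1 := (hasDerivAt_iff_isLittleO_nhds_zero.1 (boundedGroup_hasDerivAt (B N) x)).def
      (c := c / 3) (by positivity)
    filter_upwards [h1] with t ht
    have h2 := hN N le_rfl
    rw [dist_eq_norm] at h2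
    have h3 := happrox x y hxy N t
    simp only [zero_add, UnitaryGroup.zero_apply, hzero, Real.norm_eq_abs] at ht ⊢
    have h4 : L t x - x - t • -(Complex.I • y) =
        -((boundedGroup (B N)).toFun t x - L t x) +
          ((boundedGroup (B N)).toFun t x - x - t • -(Complex.I • (B N : E →L[ℂ] E) x)) +
          -(t • Complex.I • ((B N : E →L[ℂ] E) x - y)) := by
      simp only [smul_sub, smul_neg]
      abel
    have h5 : ‖-(t • Complex.I • ((B N : E →L[ℂ] E) x - y))‖ =
        |t| * ‖(B N : E →L[ℂ] E) x - y‖ := by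
      rw [norm_neg, norm_smul, norm_smul, Complex.norm_I, one_mul, Real.norm_eq_abs]
    rw [h4]
    refine norm_add₃_le.trans ?_
    rw [norm_neg, h5]
    nlinarith [abs_nonneg t]

/-- `J = (1 + iεA)⁻¹`. -/
def IsResolvent (A : E →ₗ.[ℂ] E) (ε : ℝ) (J : E →L[ℂ] E) : Prop :=
  ∀ y, ∃ z, (J y, z) ∈ A.graph ∧ J y + (ε * Complex.I : ℂ) • z = y

theorem inner_graph_comm {A : E →ₗ.[ℂ] E} (hA : IsSelfAdjoint A) {x y x' y' : E}
    (h : (x, y) ∈ A.graph) (h' : (x', y') ∈ A.graph) : ⟪y, x'⟫ = ⟪x, y'⟫ :=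
  (mem_graph_iff_of_isSelfAdjoint hA).1 h' x y h

/-- Pythagoras: $\langle x,Ax\rangle$ is real, so the cross term with $i\varepsilon Ax$ has no real
part. -/
theorem norm_sq_add_smul_graph {A : E →ₗ.[ℂ] E} (hA : IsSelfAdjoint A) (ε : ℝ) {x z : E}
    (h : (x, z) ∈ A.graph) :
    ‖x + (ε * Complex.I : ℂ) • z‖ ^ 2 = ‖x‖ ^ 2 + ε ^ 2 * ‖z‖ ^ 2 := by
  have him : (⟪x, z⟫).im = 0 := by
    have h1 := inner_graph_comm hA h h
    rw [← inner_conj_symm] at h1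
    exact Complex.conj_eq_iff_im.1 h1
  rw [@norm_add_sq ℂ, inner_smul_right, norm_smul]
  simp [him, mul_pow]

theorem eq_of_add_smul_graph {A : E →ₗ.[ℂ] E} (hA : IsSelfAdjoint A) {ε : ℝ} {x z x' z' : E}
    (h : (x, z) ∈ A.graph) (h' : (x', z') ∈ A.graph)
    (he : x + (ε * Complex.I : ℂ) • z = x' + (ε * Complex.I : ℂ) • z') : x = x' := by
  have h1 := norm_sq_add_smul_graph hA ε (A.graph.sub_mem h h')
  have h2 : x - x' + (ε * Complex.I : ℂ) • (z - z') = 0 := by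
    rw [smul_sub, ← sub_eq_zero.2 he]
    abel
  simp only at h1
  rw [h2, norm_zero] at h1
  have h3 : ‖x - x'‖ = 0 := by nlinarith [sq_nonneg ‖x - x'‖, sq_nonneg (ε * ‖z - z'‖)]
  exact sub_eq_zero.1 (norm_eq_zero.1 h3)

/-- The map $(x,Ax)\mapsto x+i\varepsilon Ax$ is bounded below on the complete graph, so its range
is closed. A vector orthogonal to the range is an eigenvector of $A^*=A$ with a non-real eigenvalue,
hence zero. -/
theorem exists_add_smul_graph {A : E →ₗ.[ℂ] E} (hA : IsSelfAdjoint A) {ε : ℝ} (hε : ε ≠ 0)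
    (y : E) : ∃ x z, (x, z) ∈ A.graph ∧ x + (ε * Complex.I : ℂ) • z = y := by
  let f : A.graph →L[ℂ] E :=
    (ContinuousLinearMap.fst ℂ E E + (ε * Complex.I : ℂ) • ContinuousLinearMap.snd ℂ E E).comp
      A.graph.subtypeL
  have hf : ∀ p : A.graph, f p = p.1.1 + (ε * Complex.I : ℂ) • p.1.2 := fun p => rfl
  have hcl : IsClosed (A.graph : Set (E × E)) := hA.isClosed
  have : CompleteSpace A.graph := hcl.completeSpace_coe
  have hclosed : IsClosed (LinearMap.range f.toLinearMap : Set E) := by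
    have hanti : AntilipschitzWith (1 + ‖ε⁻¹‖₊) f := by
      refine ContinuousLinearMap.antilipschitz_of_bound _ fun p => ?_
      have h1 := norm_sq_add_smul_graph hA ε p.2
      rw [hf]
      set u := ‖p.1.1 + (ε * Complex.I : ℂ) • p.1.2‖ with hu
      have hu0 : 0 ≤ u := norm_nonneg _
      have h2 : ‖p.1.1‖ ≤ u := abs_le_of_sq_le_sq' (by nlinarith [sq_nonneg (ε * ‖p.1.2‖)]) hu0 |>.2
      have h3 : |ε| * ‖p.1.2‖ ≤ u := abs_le_of_sq_le_sq'
        (by rw [mul_pow, sq_abs]; nlinarith [sq_nonneg ‖p.1.1‖]) hu0 |>.2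
      have h4 : ‖p.1.2‖ ≤ |ε|⁻¹ * u := by
        rw [inv_mul_eq_div, le_div_iff₀ (abs_pos.2 hε)]
        linarith
      have h5 : 0 ≤ |ε|⁻¹ * u := by positivity
      change max ‖p.1.1‖ ‖p.1.2‖ ≤ _
      simp only [NNReal.coe_add, NNReal.coe_one, coe_nnnorm, norm_inv, Real.norm_eq_abs]
      exact max_le (by linarith) (by linarith)
    exact hanti.isClosed_range f.uniformContinuous
  have htop : LinearMap.range f.toLinearMap = ⊤ := by
    have : CompleteSpace (LinearMap.range f.toLinearMap) := hclosed.completeSpace_coe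
    rw [← Submodule.orthogonal_eq_bot_iff, Submodule.eq_bot_iff]
    intro v hv
    have h1 : ∀ x z, (x, z) ∈ A.graph → ⟪x + (ε * Complex.I : ℂ) • z, v⟫ = 0 := fun x z hxz =>
      (Submodule.mem_orthogonal _ _).1 hv _ ⟨⟨(x, z), hxz⟩, rfl⟩
    have hne : (ε * Complex.I : ℂ) ≠ 0 := by simp [hε]
    -- Orthogonality to the range says $v-i\varepsilon A^*v=0$; the norm identity with
    -- $-\varepsilon$ then forces $v=0$.
    have h2 : (v, ((ε * Complex.I : ℂ))⁻¹ • v) ∈ A.graph := by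
      rw [mem_graph_iff_of_isSelfAdjoint hA]
      intro x z hxz
      have h3 := h1 x z hxz
      rw [inner_add_left, inner_smul_left] at h3
      rw [inner_smul_right]
      have h4 : (starRingEnd ℂ) (ε * Complex.I) = -(ε * Complex.I) := by simp
      rw [h4] at h3
      rw [eq_inv_mul_iff_mul_eq₀ hne]
      linear_combination -h3
    have h5 := norm_sq_add_smul_graph hA (-ε) h2
    have h6 : v + (((-ε : ℝ) : ℂ) * Complex.I) • ((ε * Complex.I : ℂ))⁻¹ • v = 0 := by
      rw [smul_smul, Complex.ofReal_neg, neg_mul, neg_mul, mul_inv_cancel₀ hne, neg_one_smul,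
        add_neg_cancel]
    rw [h6, norm_zero] at h5
    have h7 : ‖v‖ = 0 := by
      nlinarith [sq_nonneg ‖v‖, sq_nonneg (-ε * ‖((ε * Complex.I : ℂ))⁻¹ • v‖)]
    exact norm_eq_zero.1 h7
  have hy : y ∈ LinearMap.range f.toLinearMap := by rw [htop]; trivial
  obtain ⟨p, hp⟩ := hy
  exact ⟨p.1.1, p.1.2, p.2, hp⟩

theorem exists_isResolvent {A : E →ₗ.[ℂ] E} (hA : IsSelfAdjoint A) {ε : ℝ} (hε : ε ≠ 0) :
    ∃ J, IsResolvent A ε J := by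
  choose J z hJ hz using exists_add_smul_graph hA hε
  refine ⟨LinearMap.mkContinuous ⟨⟨J, fun x y => ?_⟩, fun c x => ?_⟩ 1 fun y => ?_, fun y =>
    ⟨z y, hJ y, hz y⟩⟩
  · refine eq_of_add_smul_graph hA (ε := ε) (hJ _) (A.graph.add_mem (hJ x) (hJ y)) ?_
    rw [hz]
    conv_lhs => rw [← hz x, ← hz y]
    rw [smul_add]
    abel
  · refine eq_of_add_smul_graph hA (ε := ε) (hJ _) (A.graph.smul_mem c (hJ x)) ?_
    rw [hz]
    conv_lhs => rw [← hz x]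
    rw [smul_add, smul_comm]
    rfl
  · have h1 := norm_sq_add_smul_graph hA ε (hJ y)
    rw [hz] at h1
    rw [one_mul]
    change ‖J y‖ ≤ ‖y‖
    exact abs_le_of_sq_le_sq' (by nlinarith [sq_nonneg (ε * ‖z y‖)]) (norm_nonneg _) |>.2

namespace IsResolvent

variable {A : E →ₗ.[ℂ] E} (hA : IsSelfAdjoint A) {ε : ℝ} {J : E →L[ℂ] E}
  (hJ : IsResolvent A ε J)
include hA hJ

theorem apply_eq {x z y : E} (h : (x, z) ∈ A.graph) (hy : x + (ε * Complex.I : ℂ) • z = y) :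
    J y = x := by
  obtain ⟨w, hw, hw'⟩ := hJ y
  exact eq_of_add_smul_graph hA hw h (hw'.trans hy.symm)

theorem norm_apply_le (y : E) : ‖J y‖ ≤ ‖y‖ := by
  obtain ⟨z, hz, hz'⟩ := hJ y
  have h1 := norm_sq_add_smul_graph hA ε hz
  rw [hz'] at h1
  exact abs_le_of_sq_le_sq' (by nlinarith [sq_nonneg (ε * ‖z‖)]) (norm_nonneg _) |>.2

/-- $J$ commutes with $A$ on the domain: $w=AJx=(i\varepsilon)^{-1}(x-Jx)$ is again in the domain
and solves $w+i\varepsilon Aw=z$, so $w=Jz$. -/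
theorem apply_add_smul (hε : ε ≠ 0) {x z : E} (h : (x, z) ∈ A.graph) :
    (J x, J z) ∈ A.graph ∧ J x + (ε * Complex.I : ℂ) • J z = x := by
  obtain ⟨w, hw, hw'⟩ := hJ x
  have hne : (ε * Complex.I : ℂ) ≠ 0 := by simp [hε]
  have h1 : (((ε * Complex.I : ℂ))⁻¹ • (x - J x), ((ε * Complex.I : ℂ))⁻¹ • (z - w)) ∈ A.graph :=
    A.graph.smul_mem ((ε * Complex.I : ℂ))⁻¹ (A.graph.sub_mem h hw)
  have h2 : ((ε * Complex.I : ℂ))⁻¹ • (x - J x) = w := by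
    rw [inv_smul_eq_iff₀ hne, sub_eq_iff_eq_add, add_comm, hw']
  have h3 : J z = w := by
    rw [h2] at h1
    refine hJ.apply_eq hA h1 ?_
    rw [smul_inv_smul₀ hne, add_sub_cancel]
  rw [h3]
  exact ⟨hw, hw'⟩

theorem comm (hε : ε ≠ 0) {δ : ℝ} {L : E →L[ℂ] E} (hL : IsResolvent A δ L) : Commute J L := by
  refine ContinuousLinearMap.ext fun y => ?_
  change J (L y) = L (J y)
  obtain ⟨z, hz, hz'⟩ := hL y
  refine (hL.apply_eq hA (hJ.apply_add_smul hA hε hz).1 ?_).symm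
  rw [← map_smul, ← map_add, hz']

theorem inner_apply_left {L : E →L[ℂ] E} (hL : IsResolvent A (-ε) L) (x y : E) :
    ⟪J x, y⟫ = ⟪x, L y⟫ := by
  obtain ⟨z, hz, hz'⟩ := hJ x
  obtain ⟨w, hw, hw'⟩ := hL y
  have h1 := inner_graph_comm hA hz hw
  conv_lhs => rw [← hw']
  conv_rhs => rw [← hz']
  rw [inner_add_left, inner_add_right, inner_smul_left, inner_smul_right, h1]
  simp

end IsResolvent

/-- **Stone's theorem**: a self-adjoint operator generates a unitary group. -/
theorem exists_isGeneratorOf {A : E →ₗ.[ℂ] E} (hA : IsSelfAdjoint A) :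
    ∃ U : UnitaryGroup E, IsGeneratorOf A U := by
  have hd := hA.dense_domain
  let ε : ℕ → ℝ := fun n => 1 / ((n : ℝ) + 1)
  have hε : ∀ n, ε n ≠ 0 := fun n => by positivity
  have hε' : ∀ n, -ε n ≠ 0 := fun n => neg_ne_zero.2 (hε n)
  have hε0 : Tendsto ε atTop (𝓝 0) := tendsto_one_div_add_atTop_nhds_zero_nat
  choose J hJ using fun n => exists_isResolvent hA (hε n)
  choose L hL using fun n => exists_isResolvent hA (hε' n)
  -- Resolvents tend strongly to the identity: $Rx-x=-i\delta\,RAx$ on the domain, and contractivity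
  -- extends this to all $x$.
  have hlim : ∀ (δ : ℕ → ℝ) (R : ℕ → E →L[ℂ] E), (∀ n, δ n ≠ 0) → Tendsto δ atTop (𝓝 0) →
      (∀ n, IsResolvent A (δ n) (R n)) → ∀ x, Tendsto (fun n => R n x) atTop (𝓝 x) := by
    intro δ R hδ hδ0 hR
    have h1 : ∀ x y, (x, y) ∈ A.graph → Tendsto (fun n => R n x) atTop (𝓝 x) := by
      intro x y hxy
      rw [tendsto_iff_norm_sub_tendsto_zero]
      have h2 : Tendsto (fun n => |δ n| * ‖y‖) atTop (𝓝 0) := by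
        simpa using hδ0.abs.mul_const ‖y‖
      refine squeeze_zero (fun _ => norm_nonneg _) (fun n => ?_) h2
      have h3 := ((hR n).apply_add_smul hA (hδ n) hxy).2
      have h4 : R n x - x = -((δ n * Complex.I : ℂ) • R n y) := by
        conv_lhs => rw [← h3]
        rw [h3]
        nth_rewrite 2 [← h3]
        abel
      rw [h4, norm_neg, norm_smul, norm_mul, Complex.norm_I, mul_one, Complex.norm_real,
        Real.norm_eq_abs]
      exact mul_le_mul_of_nonneg_left ((hR n).norm_apply_le hA y) (abs_nonneg _)
    have hcon : ∀ n x y, ‖R n x - R n y‖ ≤ ‖x - y‖ := fun n x y => by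
      rw [← map_sub]
      exact (hR n).norm_apply_le hA _
    choose G hG using fun x => cauchySeq_tendsto_of_complete (cauchySeq_of_dense hd
      (F := fun n x => R n x) hcon (fun x y hxy => (h1 x y hxy).cauchySeq) x)
    have hGc : Continuous G := by
      refine (LipschitzWith.of_dist_le_mul (K := 1) fun x y => ?_).continuous
      rw [dist_eq_norm, dist_eq_norm, NNReal.coe_one, one_mul]
      exact le_of_tendsto ((hG x).sub (hG y)).norm (Eventually.of_forall fun n => hcon n x y)
    have hGx : ∀ x, G x = x := dense_domain_induction hd (isClosed_eq hGc continuous_id)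
      fun x y hxy => tendsto_nhds_unique (hG x) (h1 x y hxy)
    intro x
    have := hG x
    rwa [hGx] at this
  have hJlim := hlim ε J hε hε0 hJ
  have hLlim := hlim (fun n => -ε n) L hε' (by simpa using hε0.neg) hL
  have hc2 : ∀ n, (2 * Complex.I * ε n : ℂ) ≠ 0 := fun n => by simp [hε n]
  -- The approximants are $(2i\varepsilon)^{-1}(L-J)=A(1+\varepsilon^2A^2)^{-1}$ with
  -- $L=(1-i\varepsilon A)^{-1}$ and $J=(1+i\varepsilon A)^{-1}$. They are self-adjoint because
  -- $J^*=L$, and on the domain they equal $\tfrac12(L+J)A$, which tends to $A$.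
  have hsa : ∀ n, IsSelfAdjoint ((2 * Complex.I * ε n : ℂ)⁻¹ • (L n - J n)) := by
    intro n
    rw [ContinuousLinearMap.isSelfAdjoint_iff_isSymmetric]
    intro x y
    change ⟪(2 * Complex.I * ε n : ℂ)⁻¹ • (L n x - J n x), y⟫ =
      ⟪x, (2 * Complex.I * ε n : ℂ)⁻¹ • (L n y - J n y)⟫
    have h1 := (hJ n).inner_apply_left hA (hL n) x y
    have h2 := (hL n).inner_apply_left hA (L := J n) (by rw [neg_neg]; exact hJ n) x y
    rw [inner_smul_left, inner_smul_right, inner_sub_left, inner_sub_right, h1, h2]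
    have h3 : (starRingEnd ℂ) (2 * Complex.I * ε n : ℂ)⁻¹ = -(2 * Complex.I * ε n : ℂ)⁻¹ := by
      rw [map_inv₀, ← inv_neg, map_mul, map_mul, Complex.conj_I, Complex.conj_ofReal,
        Complex.conj_ofNat]
      ring
    rw [h3]
    ring
  have hcomm : ∀ m n, Commute ((2 * Complex.I * ε m : ℂ)⁻¹ • (L m - J m))
      ((2 * Complex.I * ε n : ℂ)⁻¹ • (L n - J n)) := by
    intro m n
    have hLL := (hL m).comm hA (hε' m) (hL n)
    have hLJ := (hL m).comm hA (hε' m) (hJ n)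
    have hJL := (hJ m).comm hA (hε m) (hL n)
    have hJJ := (hJ m).comm hA (hε m) (hJ n)
    exact (((hLL.sub_right hLJ).sub_left (hJL.sub_right hJJ)).smul_left _).smul_right _
  have hconv : ∀ x y, (x, y) ∈ A.graph →
      Tendsto (fun n => ((2 * Complex.I * ε n : ℂ)⁻¹ • (L n - J n)) x) atTop (𝓝 y) := by
    intro x y hxy
    have h1 : Tendsto (fun n => (2⁻¹ : ℂ) • (L n y + J n y)) atTop (𝓝 ((2⁻¹ : ℂ) • (y + y))) :=
      ((hLlim y).add (hJlim y)).const_smul _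
    have h2 : (2⁻¹ : ℂ) • (y + y) = y := by
      rw [← two_smul ℂ y, inv_smul_smul₀ two_ne_zero]
    rw [h2] at h1
    refine h1.congr fun n => ?_
    change _ = (2 * Complex.I * ε n : ℂ)⁻¹ • (L n x - J n x)
    have h3 := ((hL n).apply_add_smul hA (hε' n) hxy).2
    have h4 := ((hJ n).apply_add_smul hA (hε n) hxy).2
    rw [eq_comm, inv_smul_eq_iff₀ (hc2 n), smul_smul]
    have h5 : (2 * Complex.I * ε n : ℂ) * 2⁻¹ = ε n * Complex.I := by ring
    rw [Complex.ofReal_neg, neg_mul, neg_smul, ← sub_eq_add_neg, sub_eq_iff_eq_add] at h3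
    rw [← eq_sub_iff_add_eq] at h4
    rw [h5, smul_add, h3, h4]
    abel
  obtain ⟨U, hU⟩ := exists_group_of_tendsto (A := A) hd (B := fun n => ⟨_, hsa n⟩) hcomm hconv
  refine ⟨U, fun x y => ⟨hU x y, fun h => ?_⟩⟩
  -- The generator of $U$ is a symmetric extension of $A$, and a self-adjoint operator has no proper
  -- one.
  rw [mem_graph_iff_of_isSelfAdjoint hA]
  intro x' y' h'
  have hK := U.isGeneratorOf_generator
  exact hK.inner_comm ((hK x' y').2 (hU x' y' h')) ((hK x y).2 h)

end StoneExistence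

/-! ### Convergence and multiplication operators in $L^2$ -/

section LpTools

variable {α : Type*} [MeasurableSpace α] {μ : Measure α}
  {E : Type*} [NormedAddCommGroup E]

/-- Dominated convergence for $\int\|G_i-f\|^2$. The representatives $G_i$ are kept apart from the
classes $F_i$ so that pointwise limits make sense for a continuous parameter. -/
theorem tendsto_L2_of_dominated {ι : Type*} {l : Filter ι} [l.IsCountablyGenerated]
    {F : ι → Lp E 2 μ} {f : Lp E 2 μ} {G : ι → α → E} (hF : ∀ i, F i =ᵐ[μ] G i) {b : α → ℝ}
    (hb : MemLp b 2 μ) (hGb : ∀ᶠ i in l, ∀ᵐ a ∂μ, ‖G i a - f a‖ ≤ b a)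
    (hlim : ∀ᵐ a ∂μ, Tendsto (fun i => G i a) l (𝓝 (f a))) : Tendsto F l (𝓝 f) := by
  rw [Lp.tendsto_Lp_iff_tendsto_eLpNorm']
  have h1 : ∀ i, eLpNorm (⇑(F i) - ⇑f) 2 μ =
      (∫⁻ a, ‖G i a - f a‖ₑ ^ (2 : ℝ) ∂μ) ^ (1 / (2 : ℝ)) := by
    intro i
    rw [eLpNorm_two_eq]
    congr 1
    refine lintegral_congr_ae ?_
    filter_upwards [hF i] with a ha
    rw [Pi.sub_apply, ha]
  simp_rw [h1]
  have h2 : Tendsto (fun i => ∫⁻ a, ‖G i a - f a‖ₑ ^ (2 : ℝ) ∂μ) l (𝓝 (∫⁻ _, 0 ∂μ)) := by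
    refine tendsto_lintegral_filter_of_dominated_convergence' (fun a => ‖b a‖ₑ ^ (2 : ℝ)) ?_ ?_ ?_ ?_
    · refine Eventually.of_forall fun i => ?_
      have h3 : AEStronglyMeasurable (fun a => G i a - f a) μ :=
        ((Lp.aestronglyMeasurable (F i)).congr (hF i)).sub (Lp.aestronglyMeasurable f)
      exact h3.enorm.pow_const _
    · filter_upwards [hGb] with i hi
      filter_upwards [hi] with a ha
      refine ENNReal.rpow_le_rpow ?_ (by norm_num)
      rw [enorm_le_iff_norm_le]
      exact ha.trans (le_abs_self _)
    · have h3 := lintegral_rpow_enorm_lt_top_of_eLpNorm_lt_top (p := 2) (by norm_num)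
        (by norm_num) hb.2
      simpa using h3.ne
    · filter_upwards [hlim] with a ha
      have h3 : Tendsto (fun i => ‖G i a - f a‖ₑ) l (𝓝 0) := by
        have := (ha.sub_const (f a)).enorm
        simpa using this
      have h4 := h3.ennrpow_const (2 : ℝ)
      rwa [ENNReal.zero_rpow_of_pos (by norm_num)] at h4
  rw [lintegral_zero] at h2
  have h3 := h2.ennrpow_const (1 / 2 : ℝ)
  rwa [ENNReal.zero_rpow_of_pos (by norm_num)] at h3

variable [InnerProductSpace ℂ E]

/-- The operator `g ↦ V ∘ g`. -/
def constOp (μ : Measure α) (V : E ≃ₗᵢ[ℂ] E) : Lp E 2 μ ≃ₗᵢ[ℂ] Lp E 2 μ where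
  toFun := V.toContinuousLinearEquiv.toContinuousLinearMap.compLp
  invFun := V.symm.toContinuousLinearEquiv.toContinuousLinearMap.compLp
  map_add' f g := map_add (V.toContinuousLinearEquiv.toContinuousLinearMap.compLpₗ 2 μ) f g
  map_smul' c f := (V.toContinuousLinearEquiv.toContinuousLinearMap.compLpₗ 2 μ).map_smul c f
  left_inv f := by
    refine Lp.ext ?_
    filter_upwards [ContinuousLinearMap.coeFn_compLp'
      V.symm.toContinuousLinearEquiv.toContinuousLinearMap
      (V.toContinuousLinearEquiv.toContinuousLinearMap.compLp f),
      ContinuousLinearMap.coeFn_compLp' V.toContinuousLinearEquiv.toContinuousLinearMap f]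
      with a h1 h2
    rw [h1, h2]
    exact V.symm_apply_apply _
  right_inv f := by
    refine Lp.ext ?_
    filter_upwards [ContinuousLinearMap.coeFn_compLp'
      V.toContinuousLinearEquiv.toContinuousLinearMap
      (V.symm.toContinuousLinearEquiv.toContinuousLinearMap.compLp f),
      ContinuousLinearMap.coeFn_compLp' V.symm.toContinuousLinearEquiv.toContinuousLinearMap f]
      with a h1 h2
    rw [h1, h2]
    exact V.apply_symm_apply _
  norm_map' f := by
    rw [Lp.norm_def, Lp.norm_def]
    congr 1
    refine eLpNorm_congr_norm_ae ?_
    filter_upwards [ContinuousLinearMap.coeFn_compLp'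
      V.toContinuousLinearEquiv.toContinuousLinearMap f] with a h1
    exact (congrArg norm h1).trans (V.norm_map _)

theorem constOp_coe (V : E ≃ₗᵢ[ℂ] E) (f : Lp E 2 μ) :
    constOp μ V f =ᵐ[μ] fun a => V (f a) :=
  ContinuousLinearMap.coeFn_compLp' V.toContinuousLinearEquiv.toContinuousLinearMap f

theorem constOp_trans (V W : E ≃ₗᵢ[ℂ] E) (f : Lp E 2 μ) :
    constOp μ V (constOp μ W f) = constOp μ (W.trans V) f := by
  refine Lp.ext ?_
  filter_upwards [constOp_coe V (constOp μ W f), constOp_coe W f, constOp_coe (W.trans V) f]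
    with a h1 h2 h3
  rw [h1, h2, h3]
  rfl

theorem constOp_smul (V : E ≃ₗᵢ[ℂ] E) (φ : Lp ℂ ∞ μ) (f : Lp E 2 μ) :
    constOp μ V (φ • f : Lp E 2 μ) = (φ • constOp μ V f : Lp E 2 μ) := by
  refine Lp.ext ?_
  filter_upwards [constOp_coe V (φ • f : Lp E 2 μ), constOp_coe V f,
    Lp.coeFn_lpSMul (r := 2) φ f, Lp.coeFn_lpSMul (r := 2) φ (constOp μ V f)] with a h1 h2 h3 h4
  rw [h1, h3, h4, Pi.smul_apply', Pi.smul_apply', h2, map_smul]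

theorem inner_smul_Linfty [CompleteSpace E] (φ : Lp ℂ ∞ μ) (f g : Lp E 2 μ) :
    inner ℂ g (φ • f : Lp E 2 μ) = ∫ a, φ a * inner ℂ (g a) (f a) ∂μ := by
  rw [L2.inner_def]
  refine integral_congr_ae ?_
  filter_upwards [Lp.coeFn_lpSMul (r := 2) φ f] with a ha
  rw [ha, Pi.smul_apply', inner_smul_right]

theorem integrable_Linfty_mul (φ : Lp ℂ ∞ μ) {h : α → ℂ} (hh : Integrable h μ) :
    Integrable (fun a => φ a * h a) μ :=
  Integrable.essSup_smul hh (Lp.aestronglyMeasurable φ) (Lp.memLp φ).2.ne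

/-- If the functions `e j` separate `L¹`, then an operator which commutes with all `M(e j)`
commutes with all `M(φ)`. -/
theorem comm_Linfty_of_separating [CompleteSpace E] {ι : Type*} (e : ι → Lp ℂ ∞ μ)
    (he : ∀ h : α → ℂ, Integrable h μ → (∀ j, ∫ a, e j a * h a ∂μ = 0) → h =ᵐ[μ] 0)
    (B : Lp E 2 μ →L[ℂ] Lp E 2 μ) (hB : ∀ j f, B (e j • f : Lp E 2 μ) = (e j • B f : Lp E 2 μ))
    (φ : Lp ℂ ∞ μ) (f : Lp E 2 μ) : B (φ • f : Lp E 2 μ) = (φ • B f : Lp E 2 μ) := by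
  refine ext_inner_left ℂ fun g => ?_
  -- The commutator is tested by $\int\psi h$ with one $h\in L^1$ that does not depend on $\psi$;
  -- separation gives $h=0$.
  have key : ∀ ψ : Lp ℂ ∞ μ, inner ℂ g (B (ψ • f : Lp E 2 μ)) - inner ℂ g (ψ • B f : Lp E 2 μ) =
      ∫ a, ψ a * (inner ℂ ((ContinuousLinearMap.adjoint B g) a) (f a) - inner ℂ (g a) ((B f) a))
        ∂μ := by
    intro ψ
    rw [← ContinuousLinearMap.adjoint_inner_left, inner_smul_Linfty, inner_smul_Linfty,
      ← integral_sub (integrable_Linfty_mul ψ (L2.integrable_inner _ _))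
        (integrable_Linfty_mul ψ (L2.integrable_inner _ _))]
    simp only [mul_sub]
  have h0 := he _ ((L2.integrable_inner (ContinuousLinearMap.adjoint B g) f).sub
    (L2.integrable_inner g (B f))) fun j => by
      refine (key (e j)).symm.trans ?_
      rw [hB, sub_self]
  rw [← sub_eq_zero, key, integral_eq_zero_of_ae]
  filter_upwards [h0] with a ha
  have ha' : inner ℂ ((ContinuousLinearMap.adjoint B g) a) (f a) - inner ℂ (g a) ((B f) a) = 0 := ha
  rw [ha', mul_zero, Pi.zero_apply]

end LpTools

/-! ### Exponentials as multipliers, and their separation of $L^1$ -/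

section Characters

variable {μ : Measure ℝ}

/-- The function `t ↦ exp (iat)`. -/
def expChar (a t : ℝ) : ℂ := Complex.exp (a * t * Complex.I)

theorem norm_expChar (a t : ℝ) : ‖expChar a t‖ = 1 := by
  rw [expChar, ← Complex.ofReal_mul, Complex.norm_exp_ofReal_mul_I]

theorem expChar_add (a b t : ℝ) : expChar (a + b) t = expChar a t * expChar b t := by
  rw [expChar, expChar, expChar, ← Complex.exp_add]
  congr 1
  push_cast
  ring

theorem expChar_zero (t : ℝ) : expChar 0 t = 1 := by simp [expChar]

theorem continuous_expChar (a : ℝ) : Continuous (expChar a) := by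
  unfold expChar
  fun_prop

theorem memLp_expChar (a : ℝ) : MemLp (expChar a) ∞ μ :=
  memLp_top_of_bound (continuous_expChar a).aestronglyMeasurable 1
    (Eventually.of_forall fun t => (norm_expChar a t).le)

variable (μ) in
/-- `t ↦ exp (iat)` as an element of `L^∞`. -/
def charLp (a : ℝ) : Lp ℂ ∞ μ := (memLp_expChar a).toLp _

theorem charLp_coe (a : ℝ) : charLp μ a =ᵐ[μ] expChar a := MemLp.coeFn_toLp _

variable {E : Type*} [NormedAddCommGroup E] [InnerProductSpace ℂ E]

theorem charLp_smul_coe (a : ℝ) (f : Lp E 2 μ) :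
    (charLp μ a • f : Lp E 2 μ) =ᵐ[μ] fun t => expChar a t • f t := by
  filter_upwards [Lp.coeFn_lpSMul (r := 2) (charLp μ a) f, charLp_coe (μ := μ) a] with t h1 h2
  rw [h1, Pi.smul_apply', h2]

theorem charLp_add_smul (a b : ℝ) (f : Lp E 2 μ) :
    (charLp μ (a + b) • f : Lp E 2 μ) = (charLp μ a • (charLp μ b • f : Lp E 2 μ) : Lp E 2 μ) := by
  refine Lp.ext ?_
  filter_upwards [charLp_smul_coe (a + b) f, charLp_smul_coe a (charLp μ b • f : Lp E 2 μ),
    charLp_smul_coe b f] with t h1 h2 h3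
  rw [h1, h2, h3, expChar_add, mul_smul]

theorem charLp_zero_smul (f : Lp E 2 μ) : (charLp μ 0 • f : Lp E 2 μ) = f := by
  refine Lp.ext ?_
  filter_upwards [charLp_smul_coe 0 f] with t h1
  rw [h1, expChar_zero, one_smul]

variable (μ E) in
/-- Multiplication by `t ↦ exp (iat)`. -/
def phase (a : ℝ) : Lp E 2 μ ≃ₗᵢ[ℂ] Lp E 2 μ where
  toFun f := charLp μ a • f
  invFun f := charLp μ (-a) • f
  map_add' f g := Lp.add_smul _ f g
  map_smul' c f := (Lp.smul_comm c (charLp μ a) f).symm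
  left_inv f := by
    change (charLp μ (-a) • (charLp μ a • f : Lp E 2 μ) : Lp E 2 μ) = f
    rw [← charLp_add_smul, neg_add_cancel, charLp_zero_smul]
  right_inv f := by
    change (charLp μ a • (charLp μ (-a) • f : Lp E 2 μ) : Lp E 2 μ) = f
    rw [← charLp_add_smul, add_neg_cancel, charLp_zero_smul]
  norm_map' f := by
    change ‖(charLp μ a • f : Lp E 2 μ)‖ = ‖f‖
    rw [Lp.norm_def, Lp.norm_def]
    congr 1
    refine eLpNorm_congr_norm_ae ?_
    filter_upwards [charLp_smul_coe a f] with t h1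
    rw [h1, norm_smul, norm_expChar, one_mul]

theorem phase_apply (a : ℝ) (f : Lp E 2 μ) : phase μ E a f = (charLp μ a • f : Lp E 2 μ) := rfl

theorem phase_coe (a : ℝ) (f : Lp E 2 μ) : phase μ E a f =ᵐ[μ] fun t => expChar a t • f t :=
  charLp_smul_coe a f

theorem phase_add (a b : ℝ) (f : Lp E 2 μ) :
    phase μ E (a + b) f = phase μ E a (phase μ E b f) := charLp_add_smul a b f

theorem phase_zero (f : Lp E 2 μ) : phase μ E 0 f = f := charLp_zero_smul f

theorem phase_apply_neg (a : ℝ) (f : Lp E 2 μ) : phase μ E a (phase μ E (-a) f) = f := by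
  rw [← phase_add, add_neg_cancel, phase_zero]

/-- The parameters of the phases with which an operator commutes. -/
def phaseCommutant {F : Type*} (P : ℝ → F → F) (h0 : ∀ f, P 0 f = f)
    (hP : ∀ a b f, P (a + b) f = P a (P b f)) (B : F → F) : AddSubgroup ℝ where
  carrier := {a | ∀ f, B (P a f) = P a (B f)}
  add_mem' := by
    intro a b ha hb f
    rw [hP, ha, hb, ← hP]
  zero_mem' f := by rw [h0, h0]
  neg_mem' := by
    intro a ha f
    have h1 : ∀ f, P (-a) (P a f) = f := fun f => by rw [← hP, neg_add_cancel, h0]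
    have h2 : P a (P (-a) f) = f := by rw [← hP, add_neg_cancel, h0]
    have h3 := ha (P (-a) f)
    rw [h2] at h3
    rw [h3, h1]

/-- The hypothesis says that the Fourier transform of $h$ vanishes. A test function is
$\psi=\mathcal F(\mathcal F^{-1}\psi)$, so $\int\psi h=\int\mathcal F^{-1}\psi\cdot\mathcal Fh=0$.
-/
theorem separating_real {h : ℝ → ℂ} (hh : Integrable h)
    (h0 : ∀ a, ∫ t, charLp volume a t * h t = 0) : h =ᵐ[volume] 0 := by
  have h1 : 𝓕 h = 0 := by
    funext w
    rw [Real.fourier_real_eq_integral_exp_smul, Pi.zero_apply, ← h0 (-2 * Real.pi * w)]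
    refine integral_congr_ae ?_
    filter_upwards [charLp_coe (μ := volume) (-2 * Real.pi * w)] with t ht
    rw [ht, expChar, smul_eq_mul]
    congr 2
    push_cast
    ring
  refine ae_eq_zero_of_integral_contDiff_smul_eq_zero hh.locallyIntegrable fun g hg hgc => ?_
  have hg₁ : HasCompactSupport (Complex.ofRealCLM ∘ g) := hgc.comp_left rfl
  have hg₂ : ContDiff ℝ (⊤ : ℕ∞) (Complex.ofRealCLM ∘ g) := by fun_prop
  set ψ : SchwartzMap ℝ ℂ := hg₁.toSchwartzMap hg₂ with hψ
  have h2 : 𝓕 (⇑(𝓕⁻ ψ : SchwartzMap ℝ ℂ)) = ⇑ψ := by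
    rw [← SchwartzMap.fourier_coe, FourierTransform.fourier_fourierInv_eq]
  have h3 := VectorFourier.integral_fourierIntegral_smul_eq_flip (L := innerₗ ℝ)
    Real.continuous_fourierChar continuous_inner ((𝓕⁻ ψ : SchwartzMap ℝ ℂ).integrable (μ := volume)) hh
  rw [flip_innerₗ] at h3
  change ∫ t, 𝓕 (⇑(𝓕⁻ ψ : SchwartzMap ℝ ℂ)) t • h t = ∫ t, (𝓕⁻ ψ : SchwartzMap ℝ ℂ) t • 𝓕 h t at h3
  rw [h1, h2] at h3
  simp only [Pi.zero_apply, smul_zero, integral_zero] at h3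
  rw [← h3]
  rfl

/-- Trigonometric polynomials are dense in the continuous functions on the circle, so $h$
annihilates all of these, in particular the test functions supported in $(0,2\pi)$. -/
theorem separating_circle {h : ℝ → ℂ} (hh : Integrable h circleMeasure)
    (h0 : ∀ n : ℤ, ∫ t, charLp circleMeasure n t * h t ∂circleMeasure = 0) :
    h =ᵐ[circleMeasure] 0 := by
  have hpi : 0 < 2 * Real.pi := by positivity
  have : Fact (0 < 2 * Real.pi) := ⟨hpi⟩
  have hint : ∀ φ : C(AddCircle (2 * Real.pi), ℂ),
      Integrable (fun t : ℝ => φ t * h t) circleMeasure := fun φ =>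
    hh.bdd_mul (c := ‖φ‖) (φ.continuous.comp (AddCircle.continuous_mk' _)).aestronglyMeasurable
      (Eventually.of_forall fun t => φ.norm_coe_le_norm t)
  let Λ : C(AddCircle (2 * Real.pi), ℂ) →L[ℂ] ℂ :=
    LinearMap.mkContinuous
      { toFun := fun φ => ∫ t : ℝ, φ t * h t ∂circleMeasure
        map_add' := fun φ ψ => by
          rw [← integral_add (hint φ) (hint ψ)]
          simp only [ContinuousMap.add_apply, add_mul]
        map_smul' := fun c φ => by
          rw [RingHom.id_apply, smul_eq_mul, ← integral_const_mul]
          simp only [ContinuousMap.smul_apply, smul_eq_mul, mul_assoc] }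
      (∫ t, ‖h t‖ ∂circleMeasure) fun φ => by
        refine le_of_le_of_eq (b := ∫ t, ‖φ‖ * ‖h t‖ ∂circleMeasure) ?_
          (by rw [integral_const_mul, mul_comm])
        refine norm_integral_le_of_norm_le (hh.norm.const_mul _) (Eventually.of_forall fun t => ?_)
        rw [norm_mul]
        exact mul_le_mul_of_nonneg_right (φ.norm_coe_le_norm t) (norm_nonneg _)
  have hΛ : ∀ φ, Λ φ = 0 := by
    have h1 : (⊤ : Submodule ℂ C(AddCircle (2 * Real.pi), ℂ)) ≤ LinearMap.ker Λ.toLinearMap := by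
      rw [← span_fourier_closure_eq_top]
      refine Submodule.topologicalClosure_minimal _ ?_ Λ.isClosed_ker
      rw [Submodule.span_le]
      rintro _ ⟨n, rfl⟩
      change ∫ t : ℝ, fourier n (t : AddCircle (2 * Real.pi)) * h t ∂circleMeasure = 0
      rw [← h0 n]
      refine integral_congr_ae ?_
      filter_upwards [charLp_coe (μ := circleMeasure) n] with t ht
      rw [ht, fourier_coe_apply, expChar]
      congr 2
      have : (Real.pi : ℂ) ≠ 0 := by exact_mod_cast Real.pi_ne_zero
      push_cast
      field_simp
    exact fun φ => h1 trivial
  have h2 : ∀ᵐ t : ℝ, t ∈ Set.Ioo 0 (2 * Real.pi) → h t = 0 := by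
    refine isOpen_Ioo.ae_eq_zero_of_integral_contDiff_smul_eq_zero
      (IntegrableOn.locallyIntegrableOn hh) fun g hg _ hgs => ?_
    have hz : ∀ t, t ∉ Set.Ioo 0 (2 * Real.pi) → g t = 0 := fun t ht =>
      image_eq_zero_of_notMem_tsupport fun h => ht (hgs h)
    let φ : C(AddCircle (2 * Real.pi), ℂ) :=
      ⟨AddCircle.liftIco (2 * Real.pi) 0 fun t => (g t : ℂ),
        AddCircle.liftIco_zero_continuous (by simp [hz])
          (Complex.continuous_ofReal.comp hg.continuous).continuousOn⟩
    have h3 : ∫ t, g t • h t = ∫ t in Set.Ioo 0 (2 * Real.pi), g t • h t := by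
      refine (setIntegral_eq_integral_of_forall_compl_eq_zero fun t ht => ?_).symm
      rw [hz t ht, zero_smul]
    rw [h3, ← hΛ φ]
    refine setIntegral_congr_fun measurableSet_Ioo fun t ht => ?_
    change g t • h t = AddCircle.liftIco (2 * Real.pi) 0 (fun t => (g t : ℂ)) (t : ℝ) * h t
    rw [AddCircle.liftIco_zero_coe_apply (Set.Ioo_subset_Ico_self ht), Complex.real_smul]
  exact (ae_restrict_iff' measurableSet_Ioo).2 h2

end Characters

/-! ### The group $e^{-is\theta}V_s$ on $L^2$ and its generator -/

section FiberedGroup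

variable {E : Type*} [NormedAddCommGroup E] [InnerProductSpace ℂ E]

local notation "⟪" x ", " y "⟫" => inner ℂ x y

theorem hasDerivAt_zero_iff_tendsto {u : ℝ → E} {u' : E} : HasDerivAt u u' 0 ↔
    Tendsto (fun t : ℝ => (t : ℂ)⁻¹ • (u t - u 0)) (𝓝[≠] 0) (𝓝 u') := by
  rw [hasDerivAt_iff_tendsto_slope_zero]
  simp only [zero_add, ← Complex.ofReal_inv, Complex.coe_smul]

/-- A single sequence of difference quotients suffices. Paired with a domain vector $z$, the
quotient moves over to $z$, where the full derivative exists; the limit says that $(x,y)$ is in the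
graph of $K^*=K$. -/
theorem IsGeneratorOf.mem_graph_of_tendsto_slope [CompleteSpace E] {K : E →ₗ.[ℂ] E}
    {U : UnitaryGroup E} (hK : IsGeneratorOf K U) {x y : E} {ι : Type*} {l : Filter ι} [l.NeBot]
    {t : ι → ℝ} (ht : Tendsto t l (𝓝[≠] 0))
    (h : Tendsto (fun i => (t i : ℂ)⁻¹ • (U.toFun (t i) x - x)) l (𝓝 (-(Complex.I • y)))) :
    (x, y) ∈ K.graph := by
  rw [mem_graph_iff_of_isSelfAdjoint hK.isSelfAdjoint]
  intro z w hzw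
  have h1 := (hasDerivAt_zero_iff_tendsto.1 (U.hasDerivAt_neg ((hK z w).1 hzw) 0)).comp ht
  have h2 := h1.inner (𝕜 := ℂ) (tendsto_const_nhds (x := x))
  have h3 := (tendsto_const_nhds (x := z)).inner (𝕜 := ℂ) h
  have h4 : ∀ i, ⟪((fun s : ℝ => (s : ℂ)⁻¹ • (U.toFun (-s) z - U.toFun (-0) z)) ∘ t) i, x⟫ =
      ⟪z, (t i : ℂ)⁻¹ • (U.toFun (t i) x - x)⟫ := by
    intro i
    have h5 := U.inner_apply_left (-t i) z x
    rw [neg_neg] at h5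
    simp only [Function.comp, neg_zero, U.zero_apply]
    rw [inner_smul_left, inner_smul_right, inner_sub_left, inner_sub_right, h5, map_inv₀,
      Complex.conj_ofReal]
  simp only [h4] at h2
  have h6 := tendsto_nhds_unique h2 h3
  simp only [neg_zero, U.zero_apply, neg_neg, inner_smul_left, inner_neg_right, inner_smul_right,
    Complex.conj_I, neg_mul, neg_inj] at h6
  exact mul_left_cancel₀ Complex.I_ne_zero h6

theorem mem_graph_smul_id_vadd {A : E →ₗ.[ℂ] E} {c : ℂ} {x y : E} :
    (x, y) ∈ ((c • (LinearMap.id : E →ₗ[ℂ] E)) +ᵥ A).graph ↔ (x, y - c • x) ∈ A.graph := by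
  rw [LinearPMap.mem_graph_iff, LinearPMap.mem_graph_iff]
  constructor
  · rintro ⟨z, hz, hy⟩
    refine ⟨z, hz, ?_⟩
    rw [LinearPMap.vadd_apply] at hy
    simp only at hz hy ⊢
    rw [← hy, ← hz]
    simp
  · rintro ⟨z, hz, hy⟩
    refine ⟨z, hz, ?_⟩
    rw [LinearPMap.vadd_apply]
    simp only at hz hy ⊢
    rw [hy, ← hz]
    simp

namespace UnitaryGroup

/-- The group `exp (-isθ) V s`. -/
def twist (V : UnitaryGroup E) (θ : ℝ) : UnitaryGroup E where
  toFun s :=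
    { toFun := fun x => expChar (-s) θ • V.toFun s x
      invFun := fun x => expChar s θ • V.toFun (-s) x
      map_add' := fun x y => by rw [LinearIsometryEquiv.map_add, smul_add]
      map_smul' := fun c x => by rw [map_smul, smul_comm, RingHom.id_apply]
      left_inv := fun x => by
        simp only [map_smul]
        rw [smul_smul, ← expChar_add, add_neg_cancel, expChar_zero, one_smul, V.neg_apply_apply]
      right_inv := fun x => by
        simp only [map_smul]
        rw [smul_smul, ← expChar_add, neg_add_cancel, expChar_zero, one_smul, V.apply_neg_apply]
      norm_map' := fun x => by
        change ‖expChar (-s) θ • V.toFun s x‖ = ‖x‖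
        rw [norm_smul, norm_expChar, one_mul, LinearIsometryEquiv.norm_map] }
  map_add s t x := by
    change expChar (-(s + t)) θ • V.toFun (s + t) x =
      expChar (-s) θ • V.toFun s (expChar (-t) θ • V.toFun t x)
    rw [map_smul, smul_smul, ← expChar_add, V.map_add, neg_add]
  strongly_continuous x := by
    have h : Continuous fun s : ℝ => expChar (-s) θ := by
      unfold expChar
      fun_prop
    exact h.smul (V.strongly_continuous x)

theorem twist_apply (V : UnitaryGroup E) (θ s : ℝ) (x : E) :
    (V.twist θ).toFun s x = expChar (-s) θ • V.toFun s x := rfl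

theorem twist_twist_neg (V : UnitaryGroup E) (θ : ℝ) : (V.twist θ).twist (-θ) = V := by
  refine UnitaryGroup.ext fun s x => ?_
  rw [twist_apply, twist_apply, smul_smul]
  have h : expChar (-s) (-θ) = expChar s θ := by
    rw [expChar, expChar]
    push_cast
    ring_nf
  rw [h, ← expChar_add, add_neg_cancel, expChar_zero, one_smul]

theorem hasDerivAt_twist {V : UnitaryGroup E} {x y : E}
    (h : HasDerivAt (fun s => V.toFun s x) (-(Complex.I • y)) 0) (θ : ℝ) :
    HasDerivAt (fun s => (V.twist θ).toFun s x) (-(Complex.I • (y + (θ : ℂ) • x))) 0 := by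
  have h1 : HasDerivAt (fun s : ℝ => expChar (-s) θ) (-(Complex.I * θ)) 0 := by
    have h2 : HasDerivAt (fun s : ℝ => (s : ℂ) * (-(Complex.I * θ))) (-(Complex.I * θ)) 0 := by
      simpa using (Complex.ofRealCLM.hasDerivAt (x := (0 : ℝ))).mul_const (-(Complex.I * θ))
    have h3 := h2.cexp
    rw [Complex.ofReal_zero, zero_mul, Complex.exp_zero, one_mul] at h3
    refine h3.congr_of_eventuallyEq (Eventually.of_forall fun s => ?_)
    change expChar (-s) θ = _
    rw [expChar]
    congr 1
    push_cast
    ring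
  have h2 := h1.smul h
  rw [neg_zero, expChar_zero, one_smul, V.zero_apply] at h2
  have h3 : -(Complex.I • y) + (-(Complex.I * θ)) • x = -(Complex.I • (y + (θ : ℂ) • x)) := by
    rw [smul_add, neg_add, smul_smul, neg_smul]
  rw [h3] at h2
  exact h2

end UnitaryGroup

/-- Product rule; the converse twists back by $-\theta$. -/
theorem IsGeneratorOf.twist {A : E →ₗ.[ℂ] E} {V : UnitaryGroup E} (hA : IsGeneratorOf A V)
    (θ : ℝ) : IsGeneratorOf (((θ : ℂ) • (LinearMap.id : E →ₗ[ℂ] E)) +ᵥ A) (V.twist θ) := by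
  intro x y
  rw [mem_graph_smul_id_vadd, hA]
  constructor
  · intro h
    have := UnitaryGroup.hasDerivAt_twist h θ
    rwa [sub_add_cancel] at this
  · intro h
    have := UnitaryGroup.hasDerivAt_twist h (-θ)
    rwa [UnitaryGroup.twist_twist_neg, Complex.ofReal_neg, neg_smul, ← sub_eq_add_neg] at this

variable (μ : Measure ℝ)

theorem constOp_phase_comm (V : E ≃ₗᵢ[ℂ] E) (a : ℝ) (f : Lp E 2 μ) :
    constOp μ V (phase μ E a f) = phase μ E a (constOp μ V f) :=
  constOp_smul V _ f

theorem fiber_coe (V : UnitaryGroup E) (s : ℝ) (f : Lp E 2 μ) :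
    phase μ E (-s) (constOp μ (V.toFun s) f) =ᵐ[μ] fun θ => (V.twist θ).toFun s (f θ) := by
  filter_upwards [phase_coe (-s) (constOp μ (V.toFun s) f), constOp_coe (V.toFun s) f]
    with θ h1 h2
  rw [h1, h2, UnitaryGroup.twist_apply]

/-- The group `f ↦ (θ ↦ exp (-isθ) V s (f θ))` on `L²`. -/
def fiberGroup (V : UnitaryGroup E) : UnitaryGroup (Lp E 2 μ) where
  toFun s := (constOp μ (V.toFun s)).trans (phase μ E (-s))
  map_add s t f := by
    change phase μ E (-(s + t)) (constOp μ (V.toFun (s + t)) f) =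
      phase μ E (-s) (constOp μ (V.toFun s) (phase μ E (-t) (constOp μ (V.toFun t) f)))
    have h : (V.toFun t).trans (V.toFun s) = V.toFun (s + t) :=
      LinearIsometryEquiv.ext fun x => (V.map_add s t x).symm
    rw [constOp_phase_comm, constOp_trans, h, ← phase_add, neg_add]
  strongly_continuous f := by
    refine continuous_iff_continuousAt.2 fun s => ?_
    refine tendsto_L2_of_dominated (fun t => fiber_coe μ V t f) (b := fun θ => ‖f θ‖ + ‖f θ‖)
      ((Lp.memLp f).norm.add (Lp.memLp f).norm) (Eventually.of_forall fun t => ?_) ?_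
    · filter_upwards [fiber_coe μ V s f] with θ h
      change ‖_ - (phase μ E (-s) (constOp μ (V.toFun s) f)) θ‖ ≤ _
      rw [h]
      refine (norm_sub_le _ _).trans ?_
      rw [LinearIsometryEquiv.norm_map, LinearIsometryEquiv.norm_map]
    · filter_upwards [fiber_coe μ V s f] with θ h
      change Tendsto _ _ (𝓝 ((phase μ E (-s) (constOp μ (V.toFun s) f)) θ))
      rw [h]
      exact ((V.twist θ).strongly_continuous (f θ)).tendsto s

theorem fiberGroup_coe (V : UnitaryGroup E) (s : ℝ) (f : Lp E 2 μ) :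
    (fiberGroup μ V).toFun s f =ᵐ[μ] fun θ => (V.twist θ).toFun s (f θ) := fiber_coe μ V s f

/-- If $(f,g)$ is in the graph fiberwise, the difference quotients at $\theta$ are bounded by
$\|g(\theta)\|$, and dominated convergence applies. If they converge in $L^2$, they converge almost
everywhere along some sequence $t_i\to0$, and `mem_graph_of_tendsto_slope` applies in each fiber. -/
theorem isGeneratorOf_fiberGroup [CompleteSpace E] {A : E →ₗ.[ℂ] E} {V : UnitaryGroup E}
    (hA : IsGeneratorOf A V) :
    IsGeneratorOf (multiplication μ fun θ : ℝ => ((θ : ℂ) • (LinearMap.id : E →ₗ[ℂ] E)) +ᵥ A)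
      (fiberGroup μ V) := by
  intro f g
  rw [mem_graph_multiplication, hasDerivAt_zero_iff_tendsto]
  have hslope : ∀ t : ℝ, ((t : ℂ)⁻¹ • ((fiberGroup μ V).toFun t f -
      (fiberGroup μ V).toFun 0 f) : Lp E 2 μ) =ᵐ[μ]
      fun θ => (t : ℂ)⁻¹ • ((V.twist θ).toFun t (f θ) - f θ) := by
    intro t
    rw [(fiberGroup μ V).zero_apply]
    filter_upwards [Lp.coeFn_smul (t : ℂ)⁻¹ ((fiberGroup μ V).toFun t f - f),
      Lp.coeFn_sub ((fiberGroup μ V).toFun t f) f, fiberGroup_coe μ V t f] with θ h1 h2 h3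
    rw [h1, Pi.smul_apply, h2, Pi.sub_apply, h3]
  have hlim : (-(Complex.I • g) : Lp E 2 μ) =ᵐ[μ] fun θ => -(Complex.I • g θ) := by
    filter_upwards [Lp.coeFn_neg (Complex.I • g), Lp.coeFn_smul Complex.I g] with θ h1 h2
    rw [h1, Pi.neg_apply, h2, Pi.smul_apply]
  constructor
  · intro h
    refine tendsto_L2_of_dominated hslope (b := fun θ => ‖g θ‖ + ‖g θ‖)
      ((Lp.memLp g).norm.add (Lp.memLp g).norm) ?_ ?_
    · filter_upwards [self_mem_nhdsWithin] with t ht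
      filter_upwards [h, hlim] with θ h1 h2
      rw [h2]
      refine (norm_sub_le _ _).trans (add_le_add ?_ ?_)
      · have h3 := (V.twist θ).norm_apply_sub_le (((hA.twist θ) _ _).1 h1) t
        rw [norm_neg, norm_smul, Complex.norm_I, one_mul] at h3
        rw [norm_smul, norm_inv, Complex.norm_real, Real.norm_eq_abs, inv_mul_le_iff₀ (abs_pos.2 ht)]
        exact h3
      · rw [norm_neg, norm_smul, Complex.norm_I, one_mul]
    · filter_upwards [h, hlim] with θ h1 h2
      rw [h2]
      have h3 := hasDerivAt_zero_iff_tendsto.1 (((hA.twist θ) _ _).1 h1)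
      simpa only [UnitaryGroup.zero_apply] using h3
  · intro h
    obtain ⟨t, ht, h1⟩ := (tendstoInMeasure_of_tendsto_Lp h).exists_seq_tendsto_ae'
    filter_upwards [h1, hlim, ae_all_iff.2 fun i => hslope (t i)] with θ h2 h3 h4
    simp only [h4, h3] at h2
    exact (hA.twist θ).mem_graph_of_tendsto_slope ht h2

end FiberedGroup

/-! ### The Fourier transform exchanges translations and phases -/

section FourierTranslation

variable {H : Type*} [NormedAddCommGroup H] [InnerProductSpace ℂ H]

theorem fourier_comp_sub (g : ℝ → H) (b w : ℝ) :
    𝓕 (fun x => g (x - b)) w = expChar (-2 * Real.pi * b) w • 𝓕 g w := by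
  rw [Real.fourier_real_eq_integral_exp_smul, Real.fourier_real_eq_integral_exp_smul,
    ← integral_smul, ← integral_add_right_eq_self _ b]
  refine integral_congr_ae (Eventually.of_forall fun x => ?_)
  simp only [smul_smul, add_sub_cancel_right]
  rw [expChar, ← Complex.exp_add]
  congr 2
  push_cast
  ring

theorem fourierInv_comp_sub (g : ℝ → H) (b w : ℝ) :
    𝓕⁻ (fun x => g (x - b)) w = expChar (2 * Real.pi * b) w • 𝓕⁻ g w := by
  rw [Real.fourierInv_eq_fourier_neg, Real.fourierInv_eq_fourier_neg, fourier_comp_sub]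
  congr 1
  rw [expChar, expChar]
  congr 1
  push_cast
  ring

theorem timeTranslation_coe (σ : ℝ) (f : L2R H) :
    timeTranslation σ f =ᵐ[volume] fun t => f (t - σ) :=
  Lp.coeFn_compMeasurePreserving f (measurePreserving_sub_right volume σ)

theorem timeTranslation_add (s t : ℝ) (f : L2R H) :
    timeTranslation (s + t) f = timeTranslation s (timeTranslation t f) := by
  refine Lp.ext ?_
  filter_upwards [timeTranslation_coe (s + t) f, timeTranslation_coe s (timeTranslation t f),
    (measurePreserving_sub_right volume s).quasiMeasurePreserving.ae (timeTranslation_coe t f)]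
    with x h1 h2 h3
  rw [h1, h2, h3, sub_sub]

theorem timeTranslation_comm (s t : ℝ) (f : L2R H) :
    timeTranslation s (timeTranslation t f) = timeTranslation t (timeTranslation s f) := by
  rw [← timeTranslation_add, add_comm, timeTranslation_add]

theorem timeTranslation_toLp (b : ℝ) (g : SchwartzMap ℝ H) :
    timeTranslation b (g.toLp 2) = (SchwartzMap.compSubConstCLM ℂ b g).toLp 2 := by
  refine Lp.ext ?_
  filter_upwards [timeTranslation_coe b (g.toLp 2),
    (measurePreserving_sub_right volume b).quasiMeasurePreserving.ae (g.coeFn_toLp 2 volume),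
    (SchwartzMap.compSubConstCLM ℂ b g).coeFn_toLp 2 volume] with x h1 h2 h3
  rw [h1, h2, h3, SchwartzMap.compSubConstCLM_apply]

variable [CompleteSpace H]

theorem L2_schwartz_induction {p : L2R H → Prop} (hp : IsClosed {f | p f})
    (h : ∀ g : SchwartzMap ℝ H, p (g.toLp 2)) (f : L2R H) : p f :=
  DenseRange.induction_on (SchwartzMap.denseRange_toLpCLM (p := 2) ENNReal.ofNat_ne_top) f hp h

/-- Both sides are continuous in $f$, so the integral formula on Schwartz functions decides. -/
theorem fourier_timeTranslation (σ : ℝ) (f : L2R H) :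
    (𝓕 (timeTranslation σ f) : L2R H) = phase volume H (-2 * Real.pi * σ) (𝓕 f : L2R H) := by
  refine L2_schwartz_induction (p := fun f => (𝓕 (timeTranslation σ f) : L2R H) =
    phase volume H (-2 * Real.pi * σ) (𝓕 f : L2R H)) (isClosed_eq ?_ ?_) (fun g => ?_) f
  · exact (Lp.fourierTransformₗᵢ ℝ H).continuous.comp (timeTranslation σ).continuous
  · exact (phase volume H _).continuous.comp (Lp.fourierTransformₗᵢ ℝ H).continuous
  · rw [timeTranslation_toLp, SchwartzMap.toLp_fourier_eq, SchwartzMap.toLp_fourier_eq]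
    refine Lp.ext ?_
    filter_upwards [phase_coe (-2 * Real.pi * σ) ((𝓕 g : SchwartzMap ℝ H).toLp 2),
      (𝓕 g : SchwartzMap ℝ H).coeFn_toLp 2 volume,
      (𝓕 (SchwartzMap.compSubConstCLM ℂ σ g) : SchwartzMap ℝ H).coeFn_toLp 2 volume]
      with w h1 h2 h3
    rw [h1, h2, h3, SchwartzMap.fourier_coe, SchwartzMap.fourier_coe]
    exact fourier_comp_sub g σ w

theorem fourierInv_timeTranslation (b : ℝ) (f : L2R H) :
    (𝓕⁻ (timeTranslation b f) : L2R H) = phase volume H (2 * Real.pi * b) (𝓕⁻ f : L2R H) := by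
  refine L2_schwartz_induction (p := fun f => (𝓕⁻ (timeTranslation b f) : L2R H) =
    phase volume H (2 * Real.pi * b) (𝓕⁻ f : L2R H)) (isClosed_eq ?_ ?_) (fun g => ?_) f
  · exact (Lp.fourierTransformₗᵢ ℝ H).symm.continuous.comp (timeTranslation b).continuous
  · exact (phase volume H _).continuous.comp (Lp.fourierTransformₗᵢ ℝ H).symm.continuous
  · rw [timeTranslation_toLp, SchwartzMap.toLp_fourierInv_eq, SchwartzMap.toLp_fourierInv_eq]
    refine Lp.ext ?_
    filter_upwards [phase_coe (2 * Real.pi * b) ((𝓕⁻ g : SchwartzMap ℝ H).toLp 2),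
      (𝓕⁻ g : SchwartzMap ℝ H).coeFn_toLp 2 volume,
      (𝓕⁻ (SchwartzMap.compSubConstCLM ℂ b g) : SchwartzMap ℝ H).coeFn_toLp 2 volume]
      with w h1 h2 h3
    rw [h1, h2, h3, SchwartzMap.fourierInv_coe, SchwartzMap.fourierInv_coe]
    exact fourierInv_comp_sub g b w

theorem fourier_phase (a : ℝ) (f : L2R H) :
    (𝓕 (phase volume H a f) : L2R H) = timeTranslation (a / (2 * Real.pi)) (𝓕 f : L2R H) := by
  have h := fourierInv_timeTranslation (a / (2 * Real.pi)) (𝓕 f : L2R H)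
  rw [FourierTransform.fourierInv_fourier_eq, mul_div_cancel₀ _ (by positivity)] at h
  rw [← h, FourierTransform.fourier_fourierInv_eq]

end FourierTranslation

/-! ### Diagonal unitaries on $\ell_2(\mathcal H)$ -/

section Ell2

variable {H : Type*} [NormedAddCommGroup H] [InnerProductSpace ℂ H]

theorem memℓp_of_norm_eq {x : Ell2 H} {y : ℤ → H} (h : ∀ n, ‖y n‖ = ‖x n‖) : Memℓp y 2 := by
  have h1 := (lp.memℓp x).summable (by norm_num)
  exact memℓp_gen (h1.congr fun n => by rw [h n])

/-- The diagonal operator `x ↦ (exp (ibn) x n)`. -/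
def modulation (b : ℝ) : Ell2 H ≃ₗᵢ[ℂ] Ell2 H where
  toFun x := ⟨fun n => expChar b n • x n,
    memℓp_of_norm_eq (x := x) fun n => by rw [norm_smul, norm_expChar, one_mul]⟩
  invFun x := ⟨fun n => expChar (-b) n • x n,
    memℓp_of_norm_eq (x := x) fun n => by rw [norm_smul, norm_expChar, one_mul]⟩
  map_add' x y := lp.ext (funext fun n => smul_add _ _ _)
  map_smul' c x := lp.ext (funext fun n => smul_comm _ _ _)
  left_inv x := lp.ext (funext fun n => by
    change expChar (-b) n • expChar b n • x n = x n
    rw [smul_smul, ← expChar_add, neg_add_cancel, expChar_zero, one_smul])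
  right_inv x := lp.ext (funext fun n => by
    change expChar b n • expChar (-b) n • x n = x n
    rw [smul_smul, ← expChar_add, add_neg_cancel, expChar_zero, one_smul])
  norm_map' x := by
    rw [lp.norm_eq_tsum_rpow (by norm_num), lp.norm_eq_tsum_rpow (by norm_num)]
    congr 1
    refine tsum_congr fun n => ?_
    change ‖expChar b n • x n‖ ^ _ = _
    rw [norm_smul, norm_expChar, one_mul]

theorem modulation_apply (b : ℝ) (x : Ell2 H) (n : ℤ) :
    modulation b x n = expChar b n • x n := rfl

theorem bilateralShift_apply (x : Ell2 H) (n : ℤ) : bilateralShift x n = x (n - 1) := rfl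

theorem expChar_neg_left (a t : ℝ) : expChar (-a) t = expChar a (-t) := by
  rw [expChar, expChar]
  push_cast
  ring_nf

theorem expChar_comm (a t : ℝ) : expChar a t = expChar t a := by
  rw [expChar, expChar, mul_comm (a : ℂ)]

/-- The source of the factor in $(*)$: $e^{ib(n-1)}=e^{-ib}e^{ibn}$, used with $b=-2\pi\sigma$. -/
theorem bilateralShift_modulation (b : ℝ) (x : Ell2 H) :
    bilateralShift (modulation b x) = expChar (-b) 1 • modulation b (bilateralShift x) := by
  refine lp.ext (funext fun n => ?_)
  rw [bilateralShift_apply, modulation_apply, lp.coeFn_smul, Pi.smul_apply, modulation_apply,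
    bilateralShift_apply, smul_smul]
  congr 1
  rw [expChar_neg_left, expChar_comm b, expChar_comm b, expChar_comm b, ← expChar_add]
  push_cast
  ring_nf

end Ell2

/-! ### Translations and phases in the fiber representation -/

section FloquetTransform

variable {H : Type*} [NormedAddCommGroup H] [InnerProductSpace ℂ H]

/-- At the point $n+\theta/2\pi$ the phase $e^{-2\pi i\sigma x}$ splits into
$e^{-i\sigma\theta}e^{-2\pi i\sigma n}$. -/
theorem fiberIsometry_phase (σ : ℝ) (h : L2R H) :
    fiberIsometry (phase volume H (-2 * Real.pi * σ) h) =
      phase circleMeasure (Ell2 H) (-σ)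
        (constOp circleMeasure (modulation (-2 * Real.pi * σ)) (fiberIsometry h)) := by
  refine Lp.ext ?_
  filter_upwards [fiberIsometry_apply (phase volume H (-2 * Real.pi * σ) h),
    fiberIsometry_apply h, ae_fibers (phase_coe (-2 * Real.pi * σ) h),
    phase_coe (-σ) (constOp circleMeasure (modulation (-2 * Real.pi * σ)) (fiberIsometry h)),
    constOp_coe (modulation (-2 * Real.pi * σ)) (fiberIsometry h)] with θ h1 h2 h3 h4 h5
  refine lp.ext (funext fun n => ?_)
  rw [h1, h3, h4, h5, lp.coeFn_smul, Pi.smul_apply, modulation_apply, h2, smul_smul, smul_smul,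
    smul_smul]
  congr 1
  rw [mul_comm fiberScale]
  congr 1
  rw [expChar, expChar, expChar, ← Complex.exp_add]
  congr 1
  have : (Real.pi : ℂ) ≠ 0 := by exact_mod_cast Real.pi_ne_zero
  push_cast
  field_simp
  ring

/-- Here $n+\theta/2\pi-a/2\pi=(n-k)+(\theta-(a-2\pi k))/2\pi$. The integer $k$ is the carry, and
the second condition on $\theta$ selects the points at which the carry is $k$. -/
theorem fiberIsometry_translate (a : ℝ) (k : ℤ) (h : L2R H) :
    ∀ᵐ θ : ℝ, θ ∈ Set.Ioo 0 (2 * Real.pi) → θ - (a - 2 * Real.pi * k) ∈ Set.Ioo 0 (2 * Real.pi) →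
      ∀ n : ℤ, fiberIsometry (timeTranslation (a / (2 * Real.pi)) h) θ n =
        fiberIsometry h (θ - (a - 2 * Real.pi * k)) (n - k) := by
  have h1 := (ae_restrict_iff' measurableSet_Ioo).1
    (fiberIsometry_apply (timeTranslation (a / (2 * Real.pi)) h))
  have h2 := (ae_restrict_iff' measurableSet_Ioo).1 (fiberIsometry_apply h)
  have h3 := (ae_restrict_iff' measurableSet_Ioo).1
    (ae_fibers (timeTranslation_coe (a / (2 * Real.pi)) h))
  have h4 := (measurePreserving_sub_right volume
    (a - 2 * Real.pi * k)).quasiMeasurePreserving.ae h2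
  filter_upwards [h1, h3, h4] with θ h1 h3 h4 hθ hθ' n
  rw [h1 hθ, h3 hθ, h4 hθ']
  congr 2
  have := Real.pi_ne_zero
  push_cast
  field_simp
  ring

variable [CompleteSpace H]

theorem floquetTransform_eq (f : L2R H) : floquetTransform f = fiberIsometry (𝓕 f : L2R H) := rfl

theorem floquetTransform_timeTranslation (σ : ℝ) (f : L2R H) :
    floquetTransform (timeTranslation σ f) = phase circleMeasure (Ell2 H) (-σ)
      (constOp circleMeasure (modulation (-2 * Real.pi * σ)) (floquetTransform f)) := by
  rw [floquetTransform_eq, fourier_timeTranslation, fiberIsometry_phase]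
  rfl

theorem floquetTransform_timeTranslation_one (f : L2R H) :
    floquetTransform (timeTranslation 1 f) =
      phase circleMeasure (Ell2 H) (-1) (floquetTransform f) := by
  rw [floquetTransform_timeTranslation]
  congr 1
  refine Lp.ext ?_
  filter_upwards [constOp_coe (modulation (-2 * Real.pi * 1)) (floquetTransform f)] with θ h
  rw [h]
  refine lp.ext (funext fun n => ?_)
  rw [modulation_apply]
  have : expChar (-2 * Real.pi * 1) n = 1 := by
    rw [expChar, Complex.exp_eq_one_iff]
    refine ⟨-n, ?_⟩
    push_cast
    ring
  rw [this, one_smul]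

theorem floquetTransform_phase (a : ℝ) (k : ℤ) (f : L2R H) :
    ∀ᵐ θ : ℝ, θ ∈ Set.Ioo 0 (2 * Real.pi) → θ - (a - 2 * Real.pi * k) ∈ Set.Ioo 0 (2 * Real.pi) →
      ∀ n : ℤ, floquetTransform (phase volume H a f) θ n =
        floquetTransform f (θ - (a - 2 * Real.pi * k)) (n - k) := by
  have h := fiberIsometry_translate a k (𝓕 f : L2R H)
  rw [← fourier_phase] at h
  exact h

/-- Translation of the Fourier transform by `a`, in the fiber representation. -/
def fiberTranslation (a : ℝ) : L2Ell2 H ≃ₗᵢ[ℂ] L2Ell2 H :=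
  (floquetTransform.symm.trans (phase volume H a)).trans floquetTransform

theorem fiberTranslation_apply (a : ℝ) (g : L2Ell2 H) :
    fiberTranslation a g = floquetTransform (phase volume H a (floquetTransform.symm g)) := rfl

theorem fiberTranslation_floquetTransform (a : ℝ) (f : L2R H) :
    fiberTranslation a (floquetTransform f) = floquetTransform (phase volume H a f) := by
  rw [fiberTranslation_apply, LinearIsometryEquiv.symm_apply_apply]

theorem fiberTranslation_coe_of_lt (a : ℝ) (g : L2Ell2 H) :
    ∀ᵐ θ : ℝ, θ ∈ Set.Ioo 0 (2 * Real.pi) → θ - a ∈ Set.Ioo 0 (2 * Real.pi) →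
      fiberTranslation a g θ = g (θ - a) := by
  have h := floquetTransform_phase a 0 (floquetTransform.symm g)
  rw [LinearIsometryEquiv.apply_symm_apply] at h
  filter_upwards [h] with θ h1 hθ hθ'
  simp only [Int.cast_zero, mul_zero, sub_zero] at h1
  exact lp.ext (funext fun n => h1 hθ hθ' n)

theorem fiberTranslation_coe_of_gt (a : ℝ) (g : L2Ell2 H) :
    ∀ᵐ θ : ℝ, θ ∈ Set.Ioo 0 (2 * Real.pi) →
      θ - (a - 2 * Real.pi) ∈ Set.Ioo 0 (2 * Real.pi) →
      fiberTranslation a g θ = bilateralShift (g (θ - (a - 2 * Real.pi))) := by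
  have h := floquetTransform_phase a 1 (floquetTransform.symm g)
  rw [LinearIsometryEquiv.apply_symm_apply] at h
  filter_upwards [h] with θ h1 hθ hθ'
  simp only [Int.cast_one, mul_one] at h1
  exact lp.ext (funext fun n => h1 hθ hθ' n)

/-- At $a=2\pi$ every $\theta$ has carry $1$ and is not moved. -/
theorem fiberTranslation_two_pi (g : L2Ell2 H) :
    fiberTranslation (2 * Real.pi) g = constOp circleMeasure bilateralShift g := by
  refine Lp.ext ?_
  have h := (ae_restrict_iff' (μ := volume) measurableSet_Ioo).2
    (fiberTranslation_coe_of_gt (2 * Real.pi) g)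
  filter_upwards [h, constOp_coe bilateralShift g, ae_restrict_mem measurableSet_Ioo]
    with θ h1 h2 hθ
  rw [sub_self, sub_zero] at h1
  rw [h2, h1 hθ]

end FloquetTransform

/-! ### Constant functions and operators that act fiberwise -/

section Constants

variable {μ : Measure ℝ} {E : Type*} [NormedAddCommGroup E] [InnerProductSpace ℂ E]

instance : IsFiniteMeasure circleMeasure :=
  ⟨by rw [Measure.restrict_apply_univ]; exact measure_Ioo_lt_top⟩

theorem two_pi_pos : 0 < 2 * Real.pi := by positivity

instance : NeZero circleMeasure := ⟨by
  intro h
  have h1 : circleMeasure Set.univ = 0 := by rw [h]; rfl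
  rw [Measure.restrict_apply_univ, Real.volume_Ioo, ENNReal.ofReal_eq_zero] at h1
  linarith [two_pi_pos]⟩

/-- The constant function `x` in `L²(0, 2π)`. -/
abbrev constFun (x : E) : Lp E 2 circleMeasure := Lp.const 2 circleMeasure x

theorem constFun_coe (x : E) : ∀ᵐ θ ∂circleMeasure, constFun x θ = x :=
  Lp.coeFn_const 2 circleMeasure x

theorem constFun_injective : Function.Injective (constFun (E := E)) := by
  intro x y h
  have h1 : ∀ᵐ θ ∂circleMeasure, x = y := by
    filter_upwards [constFun_coe x, constFun_coe y] with θ h1 h2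
    rw [← h1, h, h2]
  exact h1.exists.choose_spec

theorem constFun_add (x y : E) : constFun (x + y) = constFun x + constFun y :=
  map_add (Lp.const 2 circleMeasure) x y

theorem constFun_sub (x y : E) : constFun (x - y) = constFun x - constFun y :=
  map_sub (Lp.const 2 circleMeasure) x y

theorem constFun_smul (c : ℂ) (x : E) : constFun (c • x) = c • constFun x :=
  (Lp.constₗ 2 circleMeasure ℂ).map_smul c x

theorem exists_norm_constFun : ∃ c : ℝ, 0 < c ∧ ∀ x : E, ‖constFun x‖ = ‖x‖ * c := by
  refine ⟨circleMeasure.real Set.univ ^ (1 / (2 : ℝ≥0∞).toReal), ?_, fun x =>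
    Lp.norm_const 2 circleMeasure x (by norm_num)⟩
  exact Real.rpow_pos_of_pos measureReal_univ_pos _

theorem constOp_constFun (V : E ≃ₗᵢ[ℂ] E) (x : E) :
    constOp circleMeasure V (constFun x) = constFun (V x) := by
  refine Lp.ext ?_
  filter_upwards [constOp_coe V (constFun x), constFun_coe x, constFun_coe (V x)] with θ h1 h2 h3
  rw [h1, h2, h3]

/-- An isometry of `L²(0, 2π)` which commutes with multiplications and, together with its inverse,
maps constants to constants is given by an isometry of the fiber. -/
theorem exists_constOp (B : Lp E 2 circleMeasure ≃ₗᵢ[ℂ] Lp E 2 circleMeasure)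
    (hφ : ∀ (φ : Lp ℂ ∞ circleMeasure) f,
      B (φ • f : Lp E 2 circleMeasure) = (φ • B f : Lp E 2 circleMeasure))
    (hc : ∀ x, ∃ y, B (constFun x) = constFun y)
    (hc' : ∀ x, ∃ y, B.symm (constFun x) = constFun y) :
    ∃ V : E ≃ₗᵢ[ℂ] E, ∀ f, B f = constOp circleMeasure V f := by
  choose v hv using hc
  choose w hw using hc'
  obtain ⟨c, hc0, hc⟩ := exists_norm_constFun (E := E)
  let V : E ≃ₗᵢ[ℂ] E :=
    { toFun := v
      invFun := w
      map_add' := fun x y => constFun_injective (by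
        rw [← hv, constFun_add, map_add, hv, hv, constFun_add])
      map_smul' := fun a x => constFun_injective (by
        rw [← hv, constFun_smul, map_smul, hv, RingHom.id_apply, constFun_smul])
      left_inv := fun x => constFun_injective (by
        rw [← hw, ← hv, LinearIsometryEquiv.symm_apply_apply])
      right_inv := fun x => constFun_injective (by
        rw [← hv, ← hw, LinearIsometryEquiv.apply_symm_apply])
      norm_map' := fun x => by
        have h1 : ‖constFun (v x)‖ = ‖constFun x‖ := by rw [← hv, LinearIsometryEquiv.norm_map]
        rw [hc, hc] at h1
        exact mul_right_cancel₀ hc0.ne' h1 }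
  refine ⟨V, fun f => ?_⟩
  refine Lp.induction (by norm_num) (fun f => B f = constOp circleMeasure V f) ?_ ?_ ?_ f
  · intro x s hs hμs
    -- An indicator function with value $x$ is the multiplier $\phi$ applied to the constant $x$, so
    -- $B$ is known on it.
    let φ : Lp ℂ ∞ circleMeasure := indicatorConstLp ∞ hs hμs.ne (1 : ℂ)
    have h1 : (Lp.simpleFunc.indicatorConst 2 hs hμs.ne x : Lp E 2 circleMeasure) =
        (φ • constFun x : Lp E 2 circleMeasure) := by
      rw [Lp.simpleFunc.coe_indicatorConst]
      refine Lp.ext ?_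
      filter_upwards [indicatorConstLp_coeFn (p := 2) (hs := hs) (hμs := hμs.ne) (c := x),
        indicatorConstLp_coeFn (p := ∞) (hs := hs) (hμs := hμs.ne) (c := (1 : ℂ)),
        Lp.coeFn_lpSMul (r := 2) φ (constFun x), constFun_coe x] with θ h1 h2 h3 h4
      rw [h1, h3, Pi.smul_apply', h2, h4]
      by_cases hθ : θ ∈ s <;> simp [hθ]
    rw [h1, hφ, constOp_smul, constOp_constFun, hv]
    rfl
  · intro f g hf hg _ h1 h2
    rw [map_add, map_add, h1, h2]
  · exact isClosed_eq B.continuous (constOp circleMeasure V).continuous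

/-- Up to the sign of $s$, this is the fiber group of the trivial group. -/
theorem continuous_phase (f : Lp E 2 μ) : Continuous fun s => phase μ E s f := by
  let V : UnitaryGroup E :=
    ⟨fun _ => LinearIsometryEquiv.refl ℂ E, fun _ _ _ => rfl, fun _ => continuous_const⟩
  have h := ((fiberGroup μ V).strongly_continuous f).comp continuous_neg
  refine h.congr fun s => ?_
  change phase μ E (-(-s)) (constOp μ (LinearIsometryEquiv.refl ℂ E) f) = _
  rw [neg_neg]
  congr 1
  refine Lp.ext ?_
  filter_upwards [constOp_coe (LinearIsometryEquiv.refl ℂ E) f] with θ h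
  rw [h]
  rfl

theorem continuous_phase_comp {F : ℝ → Lp E 2 μ} (hF : Continuous F) :
    Continuous fun s => phase μ E s (F s) := by
  refine continuous_iff_continuousAt.2 fun s => ?_
  rw [ContinuousAt, tendsto_iff_norm_sub_tendsto_zero]
  have h1 := tendsto_iff_norm_sub_tendsto_zero.1 (hF.tendsto s)
  have h2 := tendsto_iff_norm_sub_tendsto_zero.1 ((continuous_phase (F s)).tendsto s)
  have h3 := h1.add h2
  rw [add_zero] at h3
  refine squeeze_zero (fun _ => norm_nonneg _) (fun t => ?_) h3
  rw [← (phase μ E t).norm_map (F t - F s), map_sub]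
  exact norm_sub_le_norm_sub_add_norm_sub _ _ _

/-- A function on `(0, 2π)` invariant under all small translations is constant. -/
theorem exists_const_of_translation_invariant {w : ℝ → E} (hw : StronglyMeasurable w)
    (h : ∀ a ∈ Set.Ioo 0 (2 * Real.pi), ∀ᵐ θ : ℝ, θ ∈ Set.Ioo 0 (2 * Real.pi) →
      θ - a ∈ Set.Ioo 0 (2 * Real.pi) → w (θ - a) = w θ) :
    ∃ y, ∀ᵐ θ ∂circleMeasure, w θ = y := by
  set I := Set.Ioo 0 (2 * Real.pi) with hI
  have hImeas : MeasurableSet I := measurableSet_Ioo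
  -- Only positive shifts are available, hence the restriction to $s<\theta$. Fubini with
  -- $s=\theta-a$ turns "all $a$, almost every $\theta$" into "almost every $\theta$, almost every
  -- $s$", and the opposite order of $s$ and $\theta$ comes from exchanging them.
  let P : ℝ → ℝ → Prop := fun θ s => θ ∈ I → s ∈ I → s < θ → w s = w θ
  have hP : MeasurableSet {p : ℝ × ℝ | P p.1 p.2} := by
    have h1 : {p : ℝ × ℝ | P p.1 p.2} =
        (Prod.fst ⁻¹' I)ᶜ ∪ ((Prod.snd ⁻¹' I)ᶜ ∪ ({p : ℝ × ℝ | p.2 < p.1}ᶜ ∪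
          {p : ℝ × ℝ | w p.2 = w p.1})) := by
      ext p
      simp only [P, Set.mem_ofPred_eq, Set.mem_union, Set.mem_compl_iff, Set.mem_preimage]
      tauto
    rw [h1]
    refine (measurable_fst hImeas).compl.union ((measurable_snd hImeas).compl.union
      ((measurableSet_lt measurable_snd measurable_fst).compl.union ?_))
    exact (hw.comp_measurable measurable_snd).measurableSet_eq_fun
      (hw.comp_measurable measurable_fst)
  have hQ : MeasurableSet {p : ℝ × ℝ | P p.2 (p.2 - p.1)} :=
    (measurable_snd.prodMk (measurable_snd.sub measurable_fst)) hP
  have h1 : ∀ᵐ a : ℝ, ∀ᵐ θ : ℝ, P θ (θ - a) := by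
    refine Eventually.of_forall fun a => ?_
    by_cases ha : a ∈ I
    · filter_upwards [h a ha] with θ h1 h2 h3 _ using h1 h2 h3
    · refine Eventually.of_forall fun θ h2 h3 h4 => absurd ⟨by linarith, ?_⟩ ha
      have := h2.2
      have := h3.1
      linarith
  have h2 : ∀ᵐ θ : ℝ, ∀ᵐ s : ℝ, P θ s := by
    filter_upwards [(Measure.ae_ae_comm hQ).1 h1] with θ h2
    have h3 := (Measure.measurePreserving_sub_left volume θ).quasiMeasurePreserving.ae h2
    simpa only [sub_sub_cancel] using h3
  have h3 : ∀ᵐ θ : ℝ, ∀ᵐ s : ℝ, P s θ := (Measure.ae_ae_comm hP).1 h2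
  have h4 : ∀ᵐ θ ∂circleMeasure, ∀ᵐ s : ℝ, s ∈ I → w s = w θ := by
    filter_upwards [ae_restrict_of_ae h2, ae_restrict_of_ae h3, ae_restrict_mem hImeas]
      with θ h2 h3 hθ
    filter_upwards [h2, h3] with s h5 h6 hs
    rcases lt_trichotomy s θ with hlt | heq | hgt
    · exact h5 hθ hs hlt
    · rw [heq]
    · exact (h6 hs hθ hgt).symm
  obtain ⟨θ, hθ⟩ := h4.exists
  exact ⟨w θ, (ae_restrict_iff' hImeas).2 hθ⟩

/-- The parameters of commuting phases form a group; it contains $-1$, hence $\mathbb Z$, and the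
$e^{in\theta}$ separate $L^1(0,2\pi)$. -/
theorem comm_Linfty_circle [CompleteSpace E]
    (B : Lp E 2 circleMeasure ≃ₗᵢ[ℂ] Lp E 2 circleMeasure)
    (hB : ∀ f, B (phase circleMeasure E (-1) f) = phase circleMeasure E (-1) (B f))
    (φ : Lp ℂ ∞ circleMeasure) (f : Lp E 2 circleMeasure) :
    B (φ • f : Lp E 2 circleMeasure) = (φ • B f : Lp E 2 circleMeasure) := by
  refine comm_Linfty_of_separating (fun n : ℤ => charLp circleMeasure n)
    (fun h hh h0 => separating_circle hh h0) B.toContinuousLinearEquiv.toContinuousLinearMap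
    (fun n => ?_) φ f
  have h1 : (-1 : ℝ) ∈ phaseCommutant (fun a => phase circleMeasure E a)
    phase_zero phase_add B := hB
  have h2 := AddSubgroup.zsmul_mem _ h1 (-n)
  rw [zsmul_eq_mul, Int.cast_neg, neg_mul_neg, mul_one] at h2
  exact h2

/-- A subgroup of $\mathbb R$ that contains $(0,2\pi]$ is everything. Shifts in this range have
carry $0$ or $1$ only. -/
theorem comm_Linfty_real [CompleteSpace E]
    (B : Lp E 2 (volume : Measure ℝ) ≃ₗᵢ[ℂ] Lp E 2 (volume : Measure ℝ))
    (hB : ∀ a ∈ Set.Ioc 0 (2 * Real.pi),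
      ∀ f, B (phase volume E a f) = phase volume E a (B f))
    (φ : Lp ℂ ∞ (volume : Measure ℝ)) (f : Lp E 2 (volume : Measure ℝ)) :
    B (φ • f : Lp E 2 (volume : Measure ℝ)) = (φ • B f : Lp E 2 (volume : Measure ℝ)) := by
  refine comm_Linfty_of_separating (fun a : ℝ => charLp volume a)
    (fun h hh h0 => separating_real hh h0) B.toContinuousLinearEquiv.toContinuousLinearMap
    (fun a => ?_) φ f
  let G := phaseCommutant (fun a => phase volume E a) phase_zero phase_add B
  have hG : ∀ a ∈ Set.Ioc 0 (2 * Real.pi), a ∈ G := hB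
  have h1 := AddSubgroup.zsmul_mem G (hG (2 * Real.pi) ⟨two_pi_pos, le_rfl⟩)
    (toIocDiv two_pi_pos 0 a)
  have h2 := hG (toIocMod two_pi_pos 0 a) (by
    have := toIocMod_mem_Ioc two_pi_pos 0 a
    rwa [zero_add] at this)
  have h3 := G.add_mem h2 h1
  rw [toIocMod_add_toIocDiv_zsmul] at h3
  exact h3

end Constants

/-! ### Operators that commute with multiplications and fiber translations -/

section Decomposition

variable {H : Type*} [NormedAddCommGroup H] [InnerProductSpace ℂ H] [CompleteSpace H]

/-- For $\theta>a$ there is no carry, so translation by $a$ fixes a constant function there. $B$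
commutes with the translation and with the cutoff to $\theta>a$, so the image is invariant under
translations inside the interval. -/
theorem exists_const_of_comm (B : L2Ell2 H ≃ₗᵢ[ℂ] L2Ell2 H)
    (hφ : ∀ (φ : Lp ℂ ∞ circleMeasure) f, B (φ • f : L2Ell2 H) = (φ • B f : L2Ell2 H))
    (hτ : ∀ a g, B (fiberTranslation a g) = fiberTranslation a (B g)) (x : Ell2 H) :
    ∃ y, B (constFun x) = constFun y := by
  have hinv : ∀ a ∈ Set.Ioo 0 (2 * Real.pi), ∀ᵐ θ : ℝ, θ ∈ Set.Ioo 0 (2 * Real.pi) →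
      θ - a ∈ Set.Ioo 0 (2 * Real.pi) → B (constFun x) (θ - a) = B (constFun x) θ := by
    intro a ha
    let φ : Lp ℂ ∞ circleMeasure :=
      indicatorConstLp ∞ (measurableSet_Ioi (a := a)) (measure_ne_top _ _) (1 : ℂ)
    have hφc : ∀ᵐ θ ∂circleMeasure, φ θ = (Set.Ioi a).indicator (fun _ => (1 : ℂ)) θ :=
      indicatorConstLp_coeFn
    have h0 : ∀ᵐ θ : ℝ, θ ∈ Set.Ioo 0 (2 * Real.pi) → constFun x θ = x :=
      (ae_restrict_iff' measurableSet_Ioo).1 (constFun_coe x)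
    have h1 : (φ • fiberTranslation a (constFun x) : L2Ell2 H) = (φ • constFun x : L2Ell2 H) := by
      refine Lp.ext ?_
      have h2 := (ae_restrict_iff' (μ := volume) measurableSet_Ioo).2
        (fiberTranslation_coe_of_lt a (constFun x))
      have h3 := ae_restrict_of_ae (s := Set.Ioo 0 (2 * Real.pi))
        ((measurePreserving_sub_right volume a).quasiMeasurePreserving.ae h0)
      filter_upwards [Lp.coeFn_lpSMul (r := 2) φ (fiberTranslation a (constFun x)),
        Lp.coeFn_lpSMul (r := 2) φ (constFun x), hφc, h2, h3, constFun_coe x,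
        ae_restrict_mem measurableSet_Ioo] with θ h4 h5 h6 h7 h8 h9 hθ
      rw [h4, h5, Pi.smul_apply', Pi.smul_apply', h6]
      by_cases hlt : a < θ
      · have h10 : θ - a ∈ Set.Ioo 0 (2 * Real.pi) :=
          ⟨by linarith, by linarith [hθ.2, ha.1]⟩
        rw [h7 h10, h8 h10, h9]
      · rw [Set.indicator_of_notMem (by simpa using hlt), zero_smul, zero_smul]
    have h2 := congrArg B h1
    rw [hφ, hφ, hτ] at h2
    have h3 : ∀ᵐ θ ∂circleMeasure, a < θ →
        fiberTranslation a (B (constFun x)) θ = B (constFun x) θ := by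
      filter_upwards [Lp.coeFn_lpSMul (r := 2) φ (fiberTranslation a (B (constFun x))),
        Lp.coeFn_lpSMul (r := 2) φ (B (constFun x)), hφc] with θ h4 h5 h6 hlt
      rw [h2, h5, Pi.smul_apply', Pi.smul_apply', h6,
        Set.indicator_of_mem (by simpa using hlt), one_smul, one_smul] at h4
      exact h4.symm
    filter_upwards [(ae_restrict_iff' measurableSet_Ioo).1 h3,
      fiberTranslation_coe_of_lt a (B (constFun x))] with θ h4 h5 hθ hθa
    rw [← h5 hθ hθa, h4 hθ (by linarith [hθa.1])]
  obtain ⟨y, hy⟩ := exists_const_of_translation_invariant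
    (Lp.stronglyMeasurable (B (constFun x))) hinv
  refine ⟨y, Lp.ext ?_⟩
  filter_upwards [hy, constFun_coe y] with θ h1 h2
  rw [h1, h2]

theorem symm_comm {F : Type*} [NormedAddCommGroup F] [InnerProductSpace ℂ F] {B : F ≃ₗᵢ[ℂ] F}
    {C : F → F} (h : ∀ f, B (C f) = C (B f)) (f : F) : B.symm (C f) = C (B.symm f) := by
  rw [LinearIsometryEquiv.symm_apply_eq, h, LinearIsometryEquiv.apply_symm_apply]

theorem exists_constOp_of_comm (B : L2Ell2 H ≃ₗᵢ[ℂ] L2Ell2 H)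
    (hB : ∀ f, B (phase circleMeasure (Ell2 H) (-1) f) =
      phase circleMeasure (Ell2 H) (-1) (B f))
    (hτ : ∀ a g, B (fiberTranslation a g) = fiberTranslation a (B g)) :
    ∃ V : Ell2 H ≃ₗᵢ[ℂ] Ell2 H, (∀ f, B f = constOp circleMeasure V f) ∧
      ∀ x, V (bilateralShift x) = bilateralShift (V x) := by
  have hφ := comm_Linfty_circle B hB
  have hφ' := comm_Linfty_circle B.symm (symm_comm hB)
  obtain ⟨V, hV⟩ := exists_constOp B hφ (exists_const_of_comm B hφ hτ)
    (exists_const_of_comm B.symm hφ' fun a => symm_comm (hτ a))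
  refine ⟨V, hV, fun x => constFun_injective ?_⟩
  have h := hτ (2 * Real.pi) (constFun x)
  rw [fiberTranslation_two_pi, fiberTranslation_two_pi, hV, hV, constOp_constFun,
    constOp_constFun, constOp_constFun, constOp_constFun] at h
  exact h

/-- A constant operator ignores translation in $\theta$, so only the carry matters: none for
$\theta>a$, and one factor $S$ for $\theta<a$. -/
theorem constOp_fiberTranslation {V : Ell2 H ≃ₗᵢ[ℂ] Ell2 H}
    (hV : ∀ x, V (bilateralShift x) = bilateralShift (V x)) {a : ℝ}
    (ha : a ∈ Set.Ioc 0 (2 * Real.pi)) (g : L2Ell2 H) :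
    constOp circleMeasure V (fiberTranslation a g) =
      fiberTranslation a (constOp circleMeasure V g) := by
  refine Lp.ext ?_
  have h0 := (ae_restrict_iff' measurableSet_Ioo).1 (constOp_coe (μ := circleMeasure) V g)
  have hne : ∀ᵐ θ : ℝ, θ ≠ a := by simp [ae_iff]
  have hlt := fiberTranslation_coe_of_lt a g
  have hgt := fiberTranslation_coe_of_gt a g
  have hlt' := fiberTranslation_coe_of_lt a (constOp circleMeasure V g)
  have hgt' := fiberTranslation_coe_of_gt a (constOp circleMeasure V g)
  have h1 := (measurePreserving_sub_right volume a).quasiMeasurePreserving.ae h0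
  have h2 := (measurePreserving_sub_right volume
    (a - 2 * Real.pi)).quasiMeasurePreserving.ae h0
  filter_upwards [constOp_coe V (fiberTranslation a g), ae_restrict_mem measurableSet_Ioo,
    ae_restrict_of_ae hne, ae_restrict_of_ae hlt, ae_restrict_of_ae hgt, ae_restrict_of_ae hlt',
    ae_restrict_of_ae hgt', ae_restrict_of_ae h1, ae_restrict_of_ae h2]
    with θ h3 hθ hne hlt hgt hlt' hgt' h1 h2
  rw [h3]
  rcases lt_or_gt_of_ne hne with h | h
  · have hm : θ - (a - 2 * Real.pi) ∈ Set.Ioo 0 (2 * Real.pi) :=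
      ⟨by linarith [hθ.1, ha.2], by linarith⟩
    rw [hgt hθ hm, hgt' hθ hm, h2 hm, hV]
  · have hm : θ - a ∈ Set.Ioo 0 (2 * Real.pi) := ⟨by linarith, by linarith [hθ.2, ha.1]⟩
    rw [hlt hθ hm, hlt' hθ hm, h1 hm]

end Decomposition

/-! ### Unitary conjugation of groups and generators -/

section Conjugation

variable {E F : Type*} [NormedAddCommGroup E] [InnerProductSpace ℂ E]
  [NormedAddCommGroup F] [InnerProductSpace ℂ F]

theorem mem_graph_unitaryConj (T : E ≃ₗᵢ[ℂ] F) (K : E →ₗ.[ℂ] E) (x y : F) :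
    (x, y) ∈ (unitaryConj T K).graph ↔ (T.symm x, T.symm y) ∈ K.graph := by
  rw [LinearPMap.mem_graph_iff, LinearPMap.mem_graph_iff]
  constructor
  · rintro ⟨z, hz, hy⟩
    refine ⟨⟨T.symm z.1, z.2⟩, ?_, ?_⟩
    · exact congrArg T.symm hz
    · have h1 : T (K ⟨T.symm z.1, z.2⟩) = y := hy
      rw [← h1]
      exact (T.symm_apply_apply _).symm
  · rintro ⟨⟨z, hz⟩, h1, h2⟩
    simp only at h1 h2
    subst h1
    refine ⟨⟨x, hz⟩, rfl, ?_⟩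
    change T (K ⟨T.symm x, hz⟩) = y
    rw [h2, LinearIsometryEquiv.apply_symm_apply]

/-- The group `T U T*`. -/
def UnitaryGroup.conj (T : E ≃ₗᵢ[ℂ] F) (U : UnitaryGroup E) : UnitaryGroup F where
  toFun s := (T.symm.trans (U.toFun s)).trans T
  map_add s t x := by
    change T (U.toFun (s + t) (T.symm x)) = T (U.toFun s (T.symm (T (U.toFun t (T.symm x)))))
    rw [T.symm_apply_apply, U.map_add]
  strongly_continuous x := T.continuous.comp (U.strongly_continuous (T.symm x))

theorem UnitaryGroup.conj_apply (T : E ≃ₗᵢ[ℂ] F) (U : UnitaryGroup E) (s : ℝ) (x : F) :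
    (UnitaryGroup.conj T U).toFun s x = T (U.toFun s (T.symm x)) := rfl

theorem IsGeneratorOf.conj {K : E →ₗ.[ℂ] E} {U : UnitaryGroup E} (hK : IsGeneratorOf K U)
    (T : E ≃ₗᵢ[ℂ] F) : IsGeneratorOf (unitaryConj T K) (UnitaryGroup.conj T U) := by
  intro x y
  rw [mem_graph_unitaryConj, hK]
  constructor
  · intro h
    have h1 := hasDerivAt_comp_isometryEquiv T h
    rwa [map_neg, map_smul, T.apply_symm_apply] at h1
  · intro h
    have h1 := hasDerivAt_comp_isometryEquiv T.symm h
    rw [map_neg, map_smul] at h1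
    refine h1.congr_of_eventuallyEq (Eventually.of_forall fun s => ?_)
    change U.toFun s (T.symm x) = T.symm (T (U.toFun s (T.symm x)))
    rw [T.symm_apply_apply]

end Conjugation

/-! ### The two directions of the theorem -/

section Main

variable {H : Type*} [NormedAddCommGroup H] [InnerProductSpace ℂ H] [CompleteSpace H]

/-- The constant function $x$ is mapped to $\theta\mapsto y+\theta x$, which is in $L^2$ on the
bounded interval, exactly when $(x,y)$ is in the graph of the fiber operator. -/
theorem fiberedOperator_injective {A B : Ell2 H →ₗ.[ℂ] Ell2 H}
    (h : fiberedOperator A = fiberedOperator B) : A = B := by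
  have key : ∀ {A B : Ell2 H →ₗ.[ℂ] Ell2 H}, fiberedOperator A = fiberedOperator B →
      ∀ x y, (x, y) ∈ A.graph → (x, y) ∈ B.graph := by
    intro A B h x y hxy
    have hid : MemLp (fun θ : ℝ => (θ : ℂ) • x) 2 circleMeasure := by
      refine MemLp.of_bound (by fun_prop) (2 * Real.pi * ‖x‖) ?_
      filter_upwards [ae_restrict_mem measurableSet_Ioo] with θ hθ
      rw [norm_smul, Complex.norm_real, Real.norm_eq_abs, abs_of_pos hθ.1]
      exact mul_le_mul_of_nonneg_right hθ.2.le (norm_nonneg _)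
    let g : L2Ell2 H := constFun y + hid.toLp _
    have hg : ∀ᵐ θ ∂circleMeasure, g θ = y + (θ : ℂ) • x := by
      filter_upwards [Lp.coeFn_add (constFun y) (hid.toLp _), constFun_coe y, hid.coeFn_toLp]
        with θ h1 h2 h3
      rw [h1, Pi.add_apply, h2, h3]
    have h1 : (constFun x, g) ∈ (fiberedOperator A).graph := by
      rw [fiberedOperator, mem_graph_multiplication]
      filter_upwards [constFun_coe x, hg] with θ h1 h2
      rw [mem_graph_smul_id_vadd, h1, h2, add_sub_cancel_right]
      exact hxy
    rw [h, fiberedOperator, mem_graph_multiplication] at h1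
    have h2 : ∀ᵐ θ ∂circleMeasure, (x, y) ∈ B.graph := by
      filter_upwards [h1, constFun_coe x, hg] with θ h1 h2 h3
      rwa [mem_graph_smul_id_vadd, h2, h3, add_sub_cancel_right] at h1
    exact h2.exists.choose_spec
  exact eq_of_mem_graph_iff fun x y => ⟨key h x y, key h.symm x y⟩

theorem expChar_two_pi (σ : ℝ) :
    expChar (-(-2 * Real.pi * σ)) 1 = Complex.exp (2 * Real.pi * Complex.I * σ) := by
  rw [expChar]
  congr 1
  push_cast
  ring

/-- The fibers of an evolution group of period `1`. -/
theorem exists_fiber_unitary {U : UnitaryGroup (L2R H)} (hU : IsEvolutionGroup U)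
    (hc : ∀ s f, U.toFun s (timeTranslation 1 f) = timeTranslation 1 (U.toFun s f)) (σ : ℝ) :
    ∃ V : Ell2 H ≃ₗᵢ[ℂ] Ell2 H,
      (∀ f, floquetTransform (U.toFun σ f) = phase circleMeasure (Ell2 H) (-σ)
        (constOp circleMeasure V (floquetTransform f))) ∧
      ∀ x, bilateralShift (V x) =
        Complex.exp (2 * Real.pi * Complex.I * σ) • V (bilateralShift x) := by
  let W : L2R H ≃ₗᵢ[ℂ] L2R H := (timeTranslation σ).symm.trans (U.toFun σ)
  have hW : ∀ f, W f = U.toFun σ ((timeTranslation σ).symm f) := fun f => rfl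
  let B : L2Ell2 H ≃ₗᵢ[ℂ] L2Ell2 H := (floquetTransform.symm.trans W).trans floquetTransform
  have hB : ∀ f, B (floquetTransform f) = floquetTransform (W f) := fun f => by
    change floquetTransform (W (floquetTransform.symm (floquetTransform f))) = _
    rw [LinearIsometryEquiv.symm_apply_apply]
  have hB1 : ∀ g, B (phase circleMeasure (Ell2 H) (-1) g) =
      phase circleMeasure (Ell2 H) (-1) (B g) := by
    intro g
    obtain ⟨f, rfl⟩ := floquetTransform.surjective g
    rw [← floquetTransform_timeTranslation_one, hB, hB, ← floquetTransform_timeTranslation_one,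
      hW, hW, symm_comm (timeTranslation_comm σ 1), hc]
  have hBτ : ∀ a g, B (fiberTranslation a g) = fiberTranslation a (B g) := by
    intro a g
    obtain ⟨f, rfl⟩ := floquetTransform.surjective g
    rw [fiberTranslation_floquetTransform, hB, hB, fiberTranslation_floquetTransform,
      phase_apply, phase_apply, hW, hW, hU]
  obtain ⟨w, hw, hwS⟩ := exists_constOp_of_comm B hB1 hBτ
  -- $U_\sigma=W_\sigma T_\sigma$, so the constant part of $T_\sigma$ joins $w$, while its phase
  -- stays outside.
  refine ⟨(modulation (-2 * Real.pi * σ)).trans w, fun f => ?_, fun x => ?_⟩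
  · have h1 : U.toFun σ f = W (timeTranslation σ f) := by
      rw [hW, LinearIsometryEquiv.symm_apply_apply]
    rw [h1, ← hB, floquetTransform_timeTranslation, hw, constOp_phase_comm, constOp_trans]
  · rw [LinearIsometryEquiv.trans_apply, LinearIsometryEquiv.trans_apply, ← hwS,
      bilateralShift_modulation, map_smul, expChar_two_pi]

/-- The group law and strong continuity of $V$ are read off on constant functions, whose norm is a
fixed positive multiple of the norm in the fiber. -/
theorem exists_fiber_group {U : UnitaryGroup (L2R H)} (hU : IsEvolutionGroup U)
    (hc : ∀ s f, U.toFun s (timeTranslation 1 f) = timeTranslation 1 (U.toFun s f)) :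
    ∃ V : UnitaryGroup (Ell2 H), UnitaryGroup.conj floquetTransform U = fiberGroup circleMeasure V ∧
      ∀ σ x, bilateralShift (V.toFun σ x) =
        Complex.exp (2 * Real.pi * Complex.I * σ) • V.toFun σ (bilateralShift x) := by
  choose V hV hVS using exists_fiber_unitary hU hc
  have hV' : ∀ s g, constOp circleMeasure (V s) g =
      phase circleMeasure (Ell2 H) s (floquetTransform (U.toFun s (floquetTransform.symm g))) := by
    intro s g
    rw [hV, phase_apply_neg, LinearIsometryEquiv.apply_symm_apply]
  refine ⟨⟨V, fun s t x => ?_, fun x => ?_⟩, UnitaryGroup.ext fun s g => ?_, hVS⟩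
  · refine constFun_injective ?_
    rw [← constOp_constFun, ← constOp_constFun, ← constOp_constFun, hV', U.map_add, hV, hV,
      LinearIsometryEquiv.apply_symm_apply, constOp_phase_comm, ← phase_add, ← phase_add]
    have : s + t + -s + -t = 0 := by ring
    rw [this, phase_zero]
  · have h1 : Continuous fun s => constFun (V s x) := by
      have h2 : Continuous fun s => floquetTransform (U.toFun s
          (floquetTransform.symm (constFun x))) :=
        floquetTransform.continuous.comp (U.strongly_continuous _)
      refine (continuous_phase_comp h2).congr fun s => ?_
      rw [← hV', constOp_constFun]
    obtain ⟨c, hc0, hc⟩ := exists_norm_constFun (E := Ell2 H)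
    refine continuous_iff_continuousAt.2 fun s => ?_
    rw [ContinuousAt, tendsto_iff_norm_sub_tendsto_zero]
    have h2 := (tendsto_iff_norm_sub_tendsto_zero.1 (h1.tendsto s)).mul_const c⁻¹
    rw [zero_mul] at h2
    refine h2.congr fun t => ?_
    rw [← constFun_sub, hc, mul_inv_cancel_right₀ hc0.ne']
  · rw [UnitaryGroup.conj_apply, hV, LinearIsometryEquiv.apply_symm_apply]
    rfl

theorem exists_fiberedOperator {K : L2R H →ₗ.[ℂ] L2R H}
    (hK : GeneratesPeriodicEvolutionGroup K 1) :
    ∃ A : Ell2 H →ₗ.[ℂ] Ell2 H, IsSelfAdjoint A ∧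
      unitaryConj floquetTransform K = fiberedOperator A ∧ ShiftRelation A := by
  obtain ⟨⟨U, hKU, hU⟩, hc⟩ := hK
  obtain ⟨V, hV, hVS⟩ := exists_fiber_group hU (hKU.commutesWith_iff.1 hc)
  have hA := V.isGeneratorOf_generator
  refine ⟨V.generator, hA.isSelfAdjoint, ?_, fun σ x => ?_⟩
  · have h1 := hKU.conj floquetTransform
    rw [hV] at h1
    exact h1.eq (isGeneratorOf_fiberGroup circleMeasure hA)
  · rw [hA.expNegI_eq, hVS]

theorem generatesPeriodicEvolutionGroup {A : Ell2 H →ₗ.[ℂ] Ell2 H} (hA : IsSelfAdjoint A)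
    (hS : ShiftRelation A) :
    GeneratesPeriodicEvolutionGroup (unitaryConj floquetTransform.symm (fiberedOperator A)) 1 := by
  obtain ⟨V, hV⟩ := exists_isGeneratorOf hA
  have hVS : ∀ σ x, bilateralShift (V.toFun σ x) =
      Complex.exp (2 * Real.pi * Complex.I * σ) • V.toFun σ (bilateralShift x) := by
    intro σ x
    rw [← hV.expNegI_eq]
    exact hS σ x
  set U := UnitaryGroup.conj floquetTransform.symm (fiberGroup circleMeasure V) with hUdef
  have hU : IsGeneratorOf (unitaryConj floquetTransform.symm (fiberedOperator A)) U :=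
    (isGeneratorOf_fiberGroup circleMeasure hV).conj floquetTransform.symm
  have hUapply : ∀ s f, floquetTransform (U.toFun s f) = phase circleMeasure (Ell2 H) (-s)
      (constOp circleMeasure (V.toFun s) (floquetTransform f)) := by
    intro s f
    rw [hUdef, UnitaryGroup.conj_apply, LinearIsometryEquiv.apply_symm_apply]
    rfl
  refine ⟨⟨U, hU, fun σ φ f => ?_⟩, hU.commutesWith_iff.2 fun s f => ?_⟩
  · let w : Ell2 H ≃ₗᵢ[ℂ] Ell2 H := (modulation (-2 * Real.pi * σ)).symm.trans (V.toFun σ)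
    let W : L2R H ≃ₗᵢ[ℂ] L2R H := (timeTranslation σ).symm.trans (U.toFun σ)
    have hW : ∀ f, floquetTransform (W f) = constOp circleMeasure w (floquetTransform f) := by
      intro f
      obtain ⟨f, rfl⟩ := (timeTranslation σ).surjective f
      change floquetTransform (U.toFun σ ((timeTranslation σ).symm (timeTranslation σ f))) = _
      have h1 : (modulation (-2 * Real.pi * σ)).trans w = V.toFun σ :=
        LinearIsometryEquiv.ext fun x => by simp [w]
      rw [LinearIsometryEquiv.symm_apply_apply, hUapply, floquetTransform_timeTranslation,
        constOp_phase_comm, constOp_trans, h1]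
    have hwS : ∀ x, w (bilateralShift x) = bilateralShift (w x) := by
      intro x
      obtain ⟨y, rfl⟩ := (modulation (-2 * Real.pi * σ)).surjective x
      have h1 : ∀ z, w (modulation (-2 * Real.pi * σ) z) = V.toFun σ z := fun z => by simp [w]
      rw [bilateralShift_modulation, map_smul, h1, h1, hVS, expChar_two_pi]
    refine comm_Linfty_real W (fun a ha f => floquetTransform.injective ?_) φ f
    rw [hW, ← fiberTranslation_floquetTransform, constOp_fiberTranslation hwS ha, ← hW,
      fiberTranslation_floquetTransform]
  · refine floquetTransform.injective ?_
    rw [hUapply, floquetTransform_timeTranslation_one, floquetTransform_timeTranslation_one,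
      hUapply, constOp_phase_comm, ← phase_add, ← phase_add, add_comm]

end Main

end Floquet

end

theorem theorem2 (H : Type*) [NormedAddCommGroup H] [InnerProductSpace ℂ H] [CompleteSpace H]
    [TopologicalSpace.SeparableSpace H] :
    (∀ K : L2R H →ₗ.[ℂ] L2R H, GeneratesPeriodicEvolutionGroup K 1 →
      ∃ Kt : Ell2 H →ₗ.[ℂ] Ell2 H,
        (IsSelfAdjoint Kt ∧ unitaryConj floquetTransform K = fiberedOperator Kt) ∧
        (∀ Kt' : Ell2 H →ₗ.[ℂ] Ell2 H,
          IsSelfAdjoint Kt' → unitaryConj floquetTransform K = fiberedOperator Kt' → Kt' = Kt) ∧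
        ShiftRelation Kt) ∧
    (∀ Kt : Ell2 H →ₗ.[ℂ] Ell2 H, IsSelfAdjoint Kt → ShiftRelation Kt →
      GeneratesPeriodicEvolutionGroup
        (unitaryConj floquetTransform.symm (fiberedOperator Kt)) 1) := by
  refine ⟨fun K hK => ?_, fun Kt hKt hS => generatesPeriodicEvolutionGroup hKt hS⟩
  obtain ⟨A, hA, hKA, hS⟩ := exists_fiberedOperator hK
  exact ⟨A, ⟨hA, hKA⟩, fun A' _ h => fiberedOperator_injective (h.symm.trans hKA), hS⟩
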